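/- **Corollary 3.6.** Let $d,n,b$ be natural numbers with $n\ge 1$ and $b\mid n$, let $R,L,m,\eta,\sigma>0$ and $M\in\mathbb R$, and let $\mathcal C_R=\{x\in\mathbb R^d:\|x\|\le R\}$ with orthogonal projection $\Pi_{\mathcal C_R}$. Let $\mathcal X$ be a set of data points and, for each $\mathbf d\in\mathcal X$, let $f(\cdot;\mathbf d)$ be a loss function which on $\mathcal C_R$ is - $L$-smooth: differentiable with $\|\nabla f(x;\mathbf d)-\nabla f(y;\mathbf d)\|\le L\|x-y\|$, - $M$-Lipschitz: $|f(x;\mathbf d)-f(y;\mathbf d)|\le M\|x-y\|$, - $m$-strongly convex: $\langle x-y,\nabla f(x;\mathbf d)-\nabla f(y;\mathbf d)\rangle\ge m\|x-y\|^2$, for all $x,y\in\mathcal C_R$ (at boundary points of $\mathcal C_R$, differentiability and the gradient are taken relative to $\mathcal C_R$). Fix a partition $\mathcal B=(\mathcal B^0,\dots,\mathcal B^{n/b-1})$ of the index set of the $n$ data points into mini-batches of size $b$. For a dataset $\mathcal D=(\mathbf d_i)_{i=1}^n\in\mathcal X^n$, one *epoch on $\mathcal D$* started at $x^0\in\mathcal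 C_R$ consists of the iterations $$x^{j+1}=\Pi_{\mathcal C_R}\Bigl(x^j-\frac{\eta}{b}\sum_{i\in\mathcal B^j}\nabla f(x^j;\mathbf d_i)+\sqrt{2\eta\sigma^2}\,W^j\Bigr),\qquad j=0,\dots,n/b-1,$$ with independent $W^j\sim\mathcal N(0,I_d)$, and has output $x^{n/b}$. Assume $\eta\le 1/L$ and put $$c=1-\eta m,\qquad Z_{\mathcal B}=\min\Bigl(\frac{1}{1-c^{n/b}}\,\frac{2\eta M}{b},\,2R\Bigr).$$ Then for every $\mathcal D\in\mathcal X^n$ there is exactly one probability measure $\nu_{\mathcal D|\mathcal B}$ on $\mathcal C_R$ that is invariant under one epoch on $\mathcal D$. Suppose that training has converged, that is, the learning algorithm $\mathcal M$ satisfies $\mathcal M(\mathcal D)\sim\nu_{\mathcal D|\mathcal B}$ for every $\mathcal D$, and let the unlearning algorithm $\mathcal U$ run $K\ge 1$ epochs on the updated dataset $\mathcal D'$, with fresh noise, started from $\mathcal M(\mathcal D)$. Then for every $\alpha>1$ the pair $(\mathcal M,\mathcal U)$ achieves $(\alpha,\varepsilon)$-Rényi unlearning with $$\varepsilon=\frac{\alpha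 Z_{\mathcal B}^2}{2\eta\sigma^2}\,c^{2Kn/b}.$$ This means: whenever $\mathcal D'$ arises from $\mathcal D$ by replacing one data point, the law $\rho$ of the output of $\mathcal U$ satisfies $$\max\bigl(D_\alpha(\rho\,\|\,\nu_{\mathcal D'|\mathcal B}),\,D_\alpha(\nu_{\mathcal D'|\mathcal B}\,\|\,\rho)\bigr)\le\varepsilon,$$ where $D_\alpha(\mu\|\nu)=\frac{1}{\alpha-1}\log\int\bigl(\frac{d\mu}{d\nu}\bigr)^{\alpha}d\nu$ if $\mu\ll\nu$, and $D_\alpha(\mu\|\nu)=+\infty$ otherwise. -/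

import Mathlib

open MeasureTheory ProbabilityTheory
open scoped ENNReal RealInnerProductSpace

noncomputable section

/-- The parameter domain: the closed Euclidean ball of radius `R` around the origin. -/
def paramBall (d : ℕ) (R : ℝ) : Set (EuclideanSpace ℝ (Fin d)) :=
  Metric.closedBall 0 R

/-- The orthogonal projection of `ℝ^d` onto the closed ball of radius `R`. -/
def projBall {d : ℕ} (R : ℝ) (x : EuclideanSpace ℝ (Fin d)) : EuclideanSpace ℝ (Fin d) :=
  if ‖x‖ ≤ R then x else (R / ‖x‖) • x

/-- `projBall R x` is a point of the ball, and the ball has no point closer to `x`. -/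
theorem projBall_spec {d : ℕ} {R : ℝ} (hR : 0 ≤ R) (x : EuclideanSpace ℝ (Fin d)) :
    projBall R x ∈ paramBall d R ∧
      ∀ y ∈ paramBall d R, ‖x - projBall R x‖ ≤ ‖x - y‖ := by
  unfold projBall paramBall
  split_ifs with h
  · simp [h]
  · push Not at h
    have hx : 0 < ‖x‖ := lt_of_le_of_lt hR h
    have hn : ‖(R / ‖x‖) • x‖ = R := by
      rw [norm_smul, Real.norm_of_nonneg (by positivity)]; field_simp
    refine ⟨by simp [hn], fun y hy => ?_⟩
    have hy' : ‖y‖ ≤ R := by simpa using hy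
    have e : x - (R / ‖x‖) • x = (1 - R / ‖x‖) • x := by rw [sub_smul, one_smul]
    have h1 : 0 ≤ 1 - R / ‖x‖ := by
      rw [sub_nonneg, div_le_one hx]; exact h.le
    have h2 : ‖x - (R / ‖x‖) • x‖ = ‖x‖ - R := by
      rw [e, norm_smul, Real.norm_of_nonneg h1]; field_simp
    rw [h2]
    linarith [norm_sub_norm_le x y]

/-- The gradient of a loss `g` that is given on the ball of radius `R`: the usual gradient
at interior points, and its counterpart relative to the ball at boundary points. If `0 < R` and `g`
is differentiable on all of `ℝ^d`, this is the usual gradient at every point of the ball. -/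
def lossGrad {d : ℕ} (R : ℝ) (g : EuclideanSpace ℝ (Fin d) → ℝ)
    (x : EuclideanSpace ℝ (Fin d)) : EuclideanSpace ℝ (Fin d) :=
  gradientWithin g (paramBall d R) x

/-- `L`-smoothness on the parameter ball: `g` is differentiable with `L`-Lipschitz gradient. -/
def IsSmoothLoss {d : ℕ} (R L : ℝ) (g : EuclideanSpace ℝ (Fin d) → ℝ) : Prop :=
  DifferentiableOn ℝ g (paramBall d R) ∧
    ∀ x ∈ paramBall d R, ∀ y ∈ paramBall d R,
      ‖lossGrad R g x - lossGrad R g y‖ ≤ L * ‖x - y‖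

/-- `M`-Lipschitz continuity on the parameter ball. -/
def IsLipschitzLoss {d : ℕ} (R M : ℝ) (g : EuclideanSpace ℝ (Fin d) → ℝ) : Prop :=
  ∀ x ∈ paramBall d R, ∀ y ∈ paramBall d R, |g x - g y| ≤ M * ‖x - y‖

/-- `m`-strong convexity on the parameter ball, in its gradient form. -/
def IsStronglyConvexLoss {d : ℕ} (R m : ℝ) (g : EuclideanSpace ℝ (Fin d) → ℝ) : Prop :=
  ∀ x ∈ paramBall d R, ∀ y ∈ paramBall d R,
    m * ‖x - y‖ ^ 2 ≤ ⟪x - y, lossGrad R g x - lossGrad R g y⟫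

/-- `B 0, …, B (q - 1)` are mini-batches of size `b` that partition the indices of the data. -/
structure IsMinibatchSequence {n q : ℕ} (b : ℕ) (B : Fin q → Finset (Fin n)) : Prop where
  card_eq : ∀ j, (B j).card = b
  disjoint : ∀ j k, j ≠ k → Disjoint (B j) (B k)
  cover : ∀ i, ∃ j, i ∈ B j

/-- The mini-batch gradient `(1/b) ∑_{i ∈ S} ∇ f(x; d_i)`. -/
def batchGrad {X : Type*} {d n : ℕ} (R : ℝ) (f : X → EuclideanSpace ℝ (Fin d) → ℝ) (b : ℕ)
    (D : Fin n → X) (S : Finset (Fin n)) (x : EuclideanSpace ℝ (Fin d)) :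
    EuclideanSpace ℝ (Fin d) :=
  (1 / (b : ℝ)) • ∑ i ∈ S, lossGrad R (f (D i)) x

/-- One iteration of projected noisy SGD, as a map on laws: if `x ∼ μ` and `W ∼ N(0, I_d)` are
independent, this is the law of `Π(x - η g(x, S) + √(2 η σ²) W)`. -/
def noisyStep {X : Type*} {d n : ℕ} (R η σ : ℝ) (f : X → EuclideanSpace ℝ (Fin d) → ℝ) (b : ℕ)
    (D : Fin n → X) (S : Finset (Fin n)) (μ : Measure (EuclideanSpace ℝ (Fin d))) :
    Measure (EuclideanSpace ℝ (Fin d)) :=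
  (μ.prod (stdGaussian (EuclideanSpace ℝ (Fin d)))).map fun p =>
    projBall R (p.1 - η • batchGrad R f b D S p.1 + Real.sqrt (2 * η * σ ^ 2) • p.2)

/-- One epoch: the iterations on `B 0, B 1, …, B (q - 1)`, in this order, with fresh noise
in each of them. -/
def epochLaw {X : Type*} {d n q : ℕ} (R η σ : ℝ) (f : X → EuclideanSpace ℝ (Fin d) → ℝ) (b : ℕ)
    (B : Fin q → Finset (Fin n)) (D : Fin n → X) (μ : Measure (EuclideanSpace ℝ (Fin d))) :
    Measure (EuclideanSpace ℝ (Fin d)) :=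
  Fin.foldl q (fun ρ j => noisyStep R η σ f b D (B j) ρ) μ

/-- The law of the parameter after `K` epochs on the dataset `D`, started from the law `μ`. -/
def epochsLaw {X : Type*} {d n q : ℕ} (R η σ : ℝ) (f : X → EuclideanSpace ℝ (Fin d) → ℝ) (b : ℕ)
    (B : Fin q → Finset (Fin n)) (K : ℕ) (D : Fin n → X)
    (μ : Measure (EuclideanSpace ℝ (Fin d))) : Measure (EuclideanSpace ℝ (Fin d)) :=
  (epochLaw R η σ f b B D)^[K] μ

/-- `ν` is a stationary law of training on `D`: a probability measure on the parameter ball that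
is invariant under one epoch. -/
structure IsStationaryLaw {X : Type*} {d n q : ℕ} (R η σ : ℝ)
    (f : X → EuclideanSpace ℝ (Fin d) → ℝ) (b : ℕ) (B : Fin q → Finset (Fin n)) (D : Fin n → X)
    (ν : Measure (EuclideanSpace ℝ (Fin d))) : Prop where
  isProbabilityMeasure : IsProbabilityMeasure ν
  supported : ν (paramBall d R)ᶜ = 0
  invariant : epochLaw R η σ f b B D ν = ν

/-- The Rényi divergence `D_α(μ ‖ ν) = (α - 1)⁻¹ log ∫ (dμ/dν)^α dν` of order `α > 1`, equal to
`+∞` if `μ` is not absolutely continuous with respect to `ν` or the integral diverges. -/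
def renyiDiv {E : Type*} [MeasurableSpace E] (α : ℝ) (μ ν : Measure E) : EReal :=
  open Classical in
  if μ ≪ ν then ((1 / (α - 1) : ℝ) : EReal) * ENNReal.log (∫⁻ x, (μ.rnDeriv ν x) ^ α ∂ν) else ⊤

/-- The Rényi difference `d_α(μ, ν) = max (D_α(μ ‖ ν)) (D_α(ν ‖ μ))`. -/
def renyiDiff {E : Type*} [MeasurableSpace E] (α : ℝ) (μ ν : Measure E) : EReal :=
  max (renyiDiv α μ ν) (renyiDiv α ν μ)

/-- Two datasets are adjacent if one is obtained from the other by replacing one data point. -/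
def AdjacentDatasets {X : Type*} {n : ℕ} (D D' : Fin n → X) : Prop :=
  ∃ (i : Fin n) (x : X), D' = Function.update D i x

/-- `(α, ε)`-Rényi unlearning, the algorithms being given through their output laws: `M D` is the
law of the learning algorithm on `D`, and `U D D' μ` is the law of the output of the unlearning
algorithm for the request `D → D'` when its input has law `μ`. -/
def IsRenyiUnlearning {X E : Type*} [MeasurableSpace E] {n : ℕ} (α ε : ℝ)
    (M : (Fin n → X) → Measure E)
    (U : (Fin n → X) → (Fin n → X) → Measure E → Measure E) : Prop :=
  ∀ D D' : Fin n → X, AdjacentDatasets D D' →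
    renyiDiff α (U D D' (M D)) (M D') ≤ (ε : EReal)

end

/-! Everything rests on couplings in the `W_∞` sense (`Coupled`). A gradient step of size `η ≤ 1 /
L` contracts the ball by `c = 1 - ηm`, because `x - η∇g(x)` is the gradient of the convex potential
`‖x‖² / 2 - ηg` (`norm_gradStep_sub_le`). The projection is nonexpansive, so two chains driven by
the same noise approach each other by a factor `c` per iteration (`Coupled.noisy`). Replacing one
data point perturbs a single iteration of the epoch by at most `e = 2ηM / b`. With `q = n / b`,
distance bounds `δ` for the stationary laws of adjacent datasets can therefore be improved to `c^q δ
+ e`, which leads to `Z` once the diameter `2R` is taken into account (`coupled_stationary_update`).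

Unlearning compares two chains on `D'`, started from the two stationary laws, one of which stays
put. Every iteration contracts the distance, and the noise of the last one turns the remaining gap
into a Rényi bound (`renyiDiv_noisyLaw_le`): after a translation of the Gaussian, the two outputs
are images under one map of the same measure with and without an explicit density, and data
processing (`lintegral_rnDeriv_map_rpow_le`) leaves a Gaussian moment.

A stationary law exists by compactness of the set of laws on the ball, since consecutive iterates of
the epoch merge. Characteristic functions convert a vanishing coupling distance into equality of
laws, which also gives uniqueness. -/

noncomputable section

/-! ### Lipschitz bounds for gradients on convex domains -/

section GradientContraction

open Set Filter Topology

variable {F : Type*} [NormedAddCommGroup F] [InnerProductSpace ℝ F] [CompleteSpace F]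

/-- First-order bounds for a function whose gradient is monotone and one-sided `c`-Lipschitz. -/
theorem first_order_bounds_of_gradient {U : Set F} (hU : Convex ℝ U) {φ : F → ℝ} {G : F → F}
    {c : ℝ} (hφ : ∀ x ∈ U, HasGradientAt φ (G x) x)
    (h0 : ∀ x ∈ U, ∀ y ∈ U, 0 ≤ ⟪G x - G y, x - y⟫)
    (h1 : ∀ x ∈ U, ∀ y ∈ U, ⟪G x - G y, x - y⟫ ≤ c * ‖x - y‖ ^ 2)
    {x y : F} (hx : x ∈ U) (hy : y ∈ U) :
    ⟪G x, y - x⟫ ≤ φ y - φ x ∧ φ y - φ x ≤ ⟪G x, y - x⟫ + c / 2 * ‖y - x‖ ^ 2 := by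
  set v := y - x with hv
  have hmem : ∀ t ∈ Icc (0 : ℝ) 1, x + t • v ∈ U := fun t ht =>
    hU.add_smul_sub_mem hx hy ht
  have hder : ∀ t ∈ Icc (0 : ℝ) 1, HasDerivAt (fun t : ℝ => φ (x + t • v)) ⟪G (x + t • v), v⟫ t := by
    intro t ht
    have e1 : HasDerivAt (fun t : ℝ => x + t • v) v t := by
      simpa using ((hasDerivAt_id t).smul_const v).const_add x
    exact ((hφ _ (hmem t ht)).hasFDerivAt.comp_hasDerivAt t e1).congr_deriv (by simp)
  have hlow : ∀ t ∈ Icc (0 : ℝ) 1, 0 ≤ t * (⟪G (x + t • v), v⟫ - ⟪G x, v⟫) := by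
    intro t ht
    have := h0 _ (hmem t ht) x hx
    rwa [add_sub_cancel_left, real_inner_smul_right, inner_sub_left] at this
  have hupp : ∀ t ∈ Icc (0 : ℝ) 1,
      t * (⟪G (x + t • v), v⟫ - ⟪G x, v⟫) ≤ t * (c * t * ‖v‖ ^ 2) := by
    intro t ht
    have := h1 _ (hmem t ht) x hx
    rw [add_sub_cancel_left, real_inner_smul_right, inner_sub_left, norm_smul, mul_pow,
      Real.norm_eq_abs, sq_abs] at this
    linarith
  have d1 : ∀ t ∈ Icc (0 : ℝ) 1, HasDerivAt (fun t : ℝ => φ (x + t • v) - t * ⟪G x, v⟫)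
      (⟪G (x + t • v), v⟫ - ⟪G x, v⟫) t := fun t ht =>
    ((hder t ht).sub ((hasDerivAt_id t).mul_const ⟪G x, v⟫)).congr_deriv (by simp)
  have d2 : ∀ t ∈ Icc (0 : ℝ) 1,
      HasDerivAt (fun t : ℝ => φ (x + t • v) - t * ⟪G x, v⟫ - t ^ 2 * (c / 2 * ‖v‖ ^ 2))
      (⟪G (x + t • v), v⟫ - ⟪G x, v⟫ - 2 * t * (c / 2 * ‖v‖ ^ 2)) t := fun t ht =>
    ((d1 t ht).sub (((hasDerivAt_id t).pow 2).mul_const (c / 2 * ‖v‖ ^ 2))).congr_deriv (by simp)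
  have z01 : (0 : ℝ) ∈ Icc (0 : ℝ) 1 := by simp
  have o01 : (1 : ℝ) ∈ Icc (0 : ℝ) 1 := by simp
  have hy' : x + v = y := by simp [hv]
  constructor
  · have hm : MonotoneOn (fun t : ℝ => φ (x + t • v) - t * ⟪G x, v⟫) (Icc 0 1) := by
      refine monotoneOn_of_deriv_nonneg (convex_Icc 0 1)
        (fun t ht => (d1 t ht).continuousAt.continuousWithinAt)
        (fun t ht => (d1 t (interior_subset ht)).differentiableAt.differentiableWithinAt) ?_
      intro t ht
      rw [(d1 t (interior_subset ht)).deriv]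
      rw [interior_Icc] at ht
      exact nonneg_of_mul_nonneg_right (hlow t (Ioo_subset_Icc_self ht)) ht.1
    have := hm z01 o01 zero_le_one
    simp only [zero_smul, add_zero, one_smul, hy', zero_mul, one_mul] at this
    linarith
  · have hm : AntitoneOn (fun t : ℝ => φ (x + t • v) - t * ⟪G x, v⟫ - t ^ 2 * (c / 2 * ‖v‖ ^ 2))
        (Icc 0 1) := by
      refine antitoneOn_of_deriv_nonpos (convex_Icc 0 1)
        (fun t ht => (d2 t ht).continuousAt.continuousWithinAt)
        (fun t ht => (d2 t (interior_subset ht)).differentiableAt.differentiableWithinAt) ?_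
      intro t ht
      rw [(d2 t (interior_subset ht)).deriv]
      rw [interior_Icc] at ht
      have := le_of_mul_le_mul_left (hupp t (Ioo_subset_Icc_self ht)) ht.1
      linarith
    have := hm z01 o01 zero_le_one
    simp only [zero_smul, add_zero, one_smul, hy', zero_mul, one_mul, one_pow, ne_eq,
      OfNat.ofNat_ne_zero, not_false_eq_true, zero_pow] at this
    linarith

/-- Local co-coercivity: the auxiliary gradient steps have to stay in the domain. -/
theorem norm_gradient_sub_le_of_mem {U : Set F} (hU : Convex ℝ U) {φ : F → ℝ} {G : F → F}
    {c : ℝ} (hc : 0 < c) (hφ : ∀ x ∈ U, HasGradientAt φ (G x) x)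
    (h0 : ∀ x ∈ U, ∀ y ∈ U, 0 ≤ ⟪G x - G y, x - y⟫)
    (h1 : ∀ x ∈ U, ∀ y ∈ U, ⟪G x - G y, x - y⟫ ≤ c * ‖x - y‖ ^ 2)
    {x y : F} (hx : x ∈ U) (hy : y ∈ U) (hxy : y - c⁻¹ • (G y - G x) ∈ U)
    (hyx : x - c⁻¹ • (G x - G y) ∈ U) : ‖G x - G y‖ ≤ c * ‖x - y‖ := by
  have key : ∀ x ∈ U, ∀ y ∈ U, y - c⁻¹ • (G y - G x) ∈ U →
      c⁻¹ / 2 * ‖G y - G x‖ ^ 2 ≤ φ y - φ x - ⟪G x, y - x⟫ := by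
    intro x hx y hy hz
    set g := G y - G x with hg
    -- `φ` at the auxiliary point `y - c⁻¹ • g` is bounded below from `x` and above from `y`.
    have a := (first_order_bounds_of_gradient hU hφ h0 h1 hx hz).1
    have b := (first_order_bounds_of_gradient hU hφ h0 h1 hy hz).2
    have e1 : y - c⁻¹ • g - x = (y - x) - c⁻¹ • g := by abel
    have e2 : y - c⁻¹ • g - y = -(c⁻¹ • g) := by abel
    rw [e1, inner_sub_right, real_inner_smul_right] at a
    rw [e2, inner_neg_right, real_inner_smul_right, norm_neg, norm_smul, mul_pow,
      Real.norm_eq_abs, sq_abs] at b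
    have e3 : ⟪G y, g⟫ - ⟪G x, g⟫ = ‖g‖ ^ 2 := by
      rw [← inner_sub_left, ← hg, real_inner_self_eq_norm_sq]
    have e4 : c / 2 * (c⁻¹ ^ 2 * ‖g‖ ^ 2) = c⁻¹ / 2 * ‖g‖ ^ 2 := by field_simp
    have e5 : c⁻¹ * ⟪G y, g⟫ - c⁻¹ * ⟪G x, g⟫ = c⁻¹ * ‖g‖ ^ 2 := by rw [← mul_sub, e3]
    linarith
  have k1 := key x hx y hy hxy
  have k2 := key y hy x hx hyx
  rw [norm_sub_rev] at k1
  have e : ⟪G x, y - x⟫ + ⟪G y, x - y⟫ = -⟪G x - G y, x - y⟫ := by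
    rw [← neg_sub x y, inner_neg_right, inner_sub_left]; ring
  -- In the sum of the two inequalities the values of `φ` cancel; what remains is co-coercivity.
  have k3 : c⁻¹ * ‖G x - G y‖ ^ 2 ≤ ⟪G x - G y, x - y⟫ := by linarith
  have k4 := k3.trans (real_inner_le_norm _ _)
  rcases (norm_nonneg (G x - G y)).eq_or_lt with h | h
  · rw [← h]; positivity
  · have : c⁻¹ * ‖G x - G y‖ ≤ ‖x - y‖ := by
      refine le_of_mul_le_mul_left ?_ h
      linarith
    rwa [inv_mul_le_iff₀ hc] at this

/-- A continuous gradient which is monotone and one-sided `c`-Lipschitz on an open convex set is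
`c`-Lipschitz there. -/
theorem norm_gradient_sub_le {U : Set F} (hU : Convex ℝ U) (hUo : IsOpen U) {φ : F → ℝ}
    {G : F → F} {c : ℝ} (hc : 0 < c) (hφ : ∀ x ∈ U, HasGradientAt φ (G x) x)
    (hG : ContinuousOn G U)
    (h0 : ∀ x ∈ U, ∀ y ∈ U, 0 ≤ ⟪G x - G y, x - y⟫)
    (h1 : ∀ x ∈ U, ∀ y ∈ U, ⟪G x - G y, x - y⟫ ≤ c * ‖x - y‖ ^ 2)
    {x y : F} (hx : x ∈ U) (hy : y ∈ U) : ‖G y - G x‖ ≤ c * ‖y - x‖ := by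
  set v := y - x with hv
  have hmem : ∀ t ∈ Icc (0 : ℝ) 1, x + t • v ∈ U := fun t ht => hU.add_smul_sub_mem hx hy ht
  -- As `w → z`, continuity of `G` sends both auxiliary points to `z`, hence into the open set `U`:
  -- co-coercivity is available near each point.
  have hloc : ∀ z ∈ U, ∀ᶠ w in 𝓝 z, ‖G w - G z‖ ≤ c * ‖w - z‖ := by
    intro z hz
    have hUz : U ∈ 𝓝 z := hUo.mem_nhds hz
    have hGz : ContinuousAt G z := hG.continuousAt hUz
    have t1 : ContinuousAt (fun w => z - c⁻¹ • (G z - G w)) z := by fun_prop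
    have t2 : ContinuousAt (fun w => w - c⁻¹ • (G w - G z)) z := by fun_prop
    have m1 : ∀ᶠ w in 𝓝 z, z - c⁻¹ • (G z - G w) ∈ U := t1.preimage_mem_nhds (by simpa using hUz)
    have m2 : ∀ᶠ w in 𝓝 z, w - c⁻¹ • (G w - G z) ∈ U := t2.preimage_mem_nhds (by simpa using hUz)
    filter_upwards [hUz, m1, m2] with w a b d
    exact norm_gradient_sub_le_of_mem hU hc hφ h0 h1 a hz b d
  have hline : Continuous fun t : ℝ => x + t • v := by fun_prop
  have hcont : ContinuousOn (fun t : ℝ => ‖G (x + t • v) - G x‖) (Icc 0 1) :=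
    ((hG.comp hline.continuousOn hmem).sub continuousOn_const).norm
  -- The mean value inequality along the segment needs only a bound on right slopes, so the local
  -- estimates give a global one with the same constant.
  have := image_le_of_liminf_slope_right_le_deriv_boundary hcont (B := fun t => t * (c * ‖v‖))
    (B' := fun _ => c * ‖v‖) (by simp) (by fun_prop)
    (fun t _ => by simpa using ((hasDerivAt_id t).mul_const (c * ‖v‖)).hasDerivWithinAt) ?_
    (right_mem_Icc.2 zero_le_one)
  · simpa [hv] using this
  · intro t ht r hr
    refine Eventually.frequently ?_
    have ev : ∀ᶠ z in 𝓝[>] t, ‖G (x + z • v) - G (x + t • v)‖ ≤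
        c * ‖(x + z • v) - (x + t • v)‖ :=
      (hline.continuousAt.eventually (hloc _ (hmem t (Ico_subset_Icc_self ht)))).filter_mono
        nhdsWithin_le_nhds
    filter_upwards [ev, self_mem_nhdsWithin] with z hz hzt
    have hzt' : 0 < z - t := sub_pos.2 hzt
    refine lt_of_le_of_lt ?_ hr
    rw [slope_def_field, div_le_iff₀ hzt']
    have e : (x + z • v) - (x + t • v) = (z - t) • v := by rw [sub_smul]; abel
    rw [e, norm_smul, Real.norm_of_nonneg hzt'.le] at hz
    have := norm_sub_norm_le (G (x + z • v) - G x) (G (x + t • v) - G x)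
    rw [sub_sub_sub_cancel_right] at this
    linarith

end GradientContraction

/-! ### Projection onto the ball -/

section Projection

variable {d : ℕ} {R : ℝ}

theorem mem_paramBall {x : EuclideanSpace ℝ (Fin d)} : x ∈ paramBall d R ↔ ‖x‖ ≤ R := by
  simp [paramBall]

theorem projBall_mem (hR : 0 ≤ R) (x : EuclideanSpace ℝ (Fin d)) : projBall R x ∈ paramBall d R :=
  (projBall_spec hR x).1

theorem projBall_of_mem {x : EuclideanSpace ℝ (Fin d)} (hx : x ∈ paramBall d R) :
    projBall R x = x :=
  if_pos (mem_paramBall.1 hx)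

theorem inner_sub_projBall_nonpos (hR : 0 ≤ R) (x : EuclideanSpace ℝ (Fin d))
    {y : EuclideanSpace ℝ (Fin d)} (hy : y ∈ paramBall d R) :
    ⟪x - projBall R x, y - projBall R x⟫ ≤ 0 := by
  unfold projBall
  split_ifs with h
  · simp
  · push Not at h
    have hx : 0 < ‖x‖ := hR.trans_lt h
    have e : x - (R / ‖x‖) • x = (1 - R / ‖x‖) • x := by rw [sub_smul, one_smul]
    have h1 : 0 ≤ 1 - R / ‖x‖ := by rw [sub_nonneg, div_le_one hx]; exact h.le
    have h2 : ⟪x, y⟫ ≤ ‖x‖ * R :=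
      (real_inner_le_norm _ _).trans (by gcongr; exact mem_paramBall.1 hy)
    have h3 : R / ‖x‖ * ‖x‖ ^ 2 = ‖x‖ * R := by field_simp
    rw [e, real_inner_smul_left, inner_sub_right, real_inner_smul_right,
      real_inner_self_eq_norm_sq, h3]
    exact mul_nonpos_of_nonneg_of_nonpos h1 (by linarith)

/-- Adding the variational inequalities at the two projections gives firm nonexpansiveness, `‖p -
q‖² ≤ ⟪x - y, p - q⟫`; Cauchy–Schwarz finishes. -/
theorem norm_projBall_sub_le (hR : 0 ≤ R) (x y : EuclideanSpace ℝ (Fin d)) :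
    ‖projBall R x - projBall R y‖ ≤ ‖x - y‖ := by
  have h1 := inner_sub_projBall_nonpos hR x (projBall_mem hR y)
  have h2 := inner_sub_projBall_nonpos hR y (projBall_mem hR x)
  set p := projBall R x
  set q := projBall R y
  have h3 : ‖p - q‖ ^ 2 ≤ ⟪x - y, p - q⟫ := by
    rw [← real_inner_self_eq_norm_sq]
    have e : ⟪x - y, p - q⟫ - ⟪p - q, p - q⟫ = -⟪x - p, q - p⟫ - ⟪y - q, p - q⟫ := by
      rw [← inner_sub_left, ← neg_sub p q, inner_neg_right, neg_neg, ← inner_sub_left]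
      congr 1; abel
    linarith
  have h4 := h3.trans (real_inner_le_norm _ _)
  rcases (norm_nonneg (p - q)).eq_or_lt with h | h
  · rw [← h]; exact norm_nonneg _
  · refine le_of_mul_le_mul_right ?_ h
    linarith

theorem continuous_projBall (hR : 0 ≤ R) :
    Continuous (projBall R : EuclideanSpace ℝ (Fin d) → EuclideanSpace ℝ (Fin d)) :=
  (LipschitzWith.of_dist_le_mul (K := 1) fun x y => by
    simpa [dist_eq_norm] using norm_projBall_sub_le hR x y).continuous

theorem measurableSet_paramBall : MeasurableSet (paramBall d R) :=
  Metric.isClosed_closedBall.measurableSet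

end Projection

/-! ### Gradients of the losses and the contracting gradient step -/

section LossGradient

open Set Metric

variable {d : ℕ} {R L M m η : ℝ} {g : EuclideanSpace ℝ (Fin d) → ℝ}

theorem IsSmoothLoss.continuousOn_lossGrad (h : IsSmoothLoss R L g) :
    ContinuousOn (lossGrad R g) (paramBall d R) :=
  (LipschitzOnWith.of_dist_le_mul (K := L.toNNReal) fun x hx y hy => by
    rw [dist_eq_norm, dist_eq_norm]
    exact (h.2 x hx y hy).trans (by gcongr; exact Real.le_coe_toNNReal L)).continuousOn

/-- Laws are pushed forward along maps on all of `ℝ^d`, so measurability is needed off the ball too,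
where the relative gradient has its default value zero. -/
theorem IsSmoothLoss.measurable_lossGrad (h : IsSmoothLoss R L g) : Measurable (lossGrad R g) := by
  have hz : ∀ x ∉ paramBall d R, lossGrad R g x = 0 := by
    intro x hx
    have hx' : x ∉ closure (paramBall d R) := by
      rwa [paramBall, isClosed_closedBall.closure_eq]
    rw [lossGrad, gradientWithin, fderivWithin_zero_of_notMem_closure hx', map_zero]
  classical
  have e : lossGrad R g = (paramBall d R).piecewise (lossGrad R g) fun _ => 0 := by
    funext x
    by_cases hx : x ∈ paramBall d R
    · simp [hx]
    · simp [hx, hz x hx]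
  rw [e]
  exact h.continuousOn_lossGrad.measurable_piecewise continuousOn_const measurableSet_paramBall

theorem IsSmoothLoss.hasGradientAt_lossGrad (h : IsSmoothLoss R L g)
    {x : EuclideanSpace ℝ (Fin d)} (hx : x ∈ ball (0 : EuclideanSpace ℝ (Fin d)) R) :
    HasGradientAt g (lossGrad R g x) x := by
  have hn : paramBall d R ∈ nhds x := closedBall_mem_nhds_of_mem hx
  have e : lossGrad R g x = gradient g x := by
    rw [lossGrad, gradientWithin, gradient, fderivWithin_of_mem_nhds hn]
  rw [e]
  exact h.1.hasGradientAt hn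

theorem closure_openBall_eq_paramBall (hR : 0 < R) :
    closure (ball (0 : EuclideanSpace ℝ (Fin d)) R) = paramBall d R :=
  closure_ball 0 hR.ne'

/-- In the open ball the relative gradient is a genuine one and is bounded by the Lipschitz
constant; continuity carries the bound to the boundary. -/
theorem norm_lossGrad_le (hR : 0 < R) (hM : 0 ≤ M) (h : IsSmoothLoss R L g)
    (hl : IsLipschitzLoss R M g) {x : EuclideanSpace ℝ (Fin d)} (hx : x ∈ paramBall d R) :
    ‖lossGrad R g x‖ ≤ M := by
  rw [← closure_openBall_eq_paramBall hR] at hx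
  refine le_on_closure (f := fun x => ‖lossGrad R g x‖) (g := fun _ => M) ?_ ?_
    continuousOn_const hx
  · intro y hy
    have hl' : LipschitzOnWith M.toNNReal g (paramBall d R) :=
      LipschitzOnWith.of_dist_le_mul fun x hx y hy => by
        rw [dist_eq_norm, dist_eq_norm, Real.norm_eq_abs, Real.coe_toNNReal M hM]
        exact hl x hx y hy
    have := (h.hasGradientAt_lossGrad hy).hasFDerivAt.le_of_lipschitzOn
      (closedBall_mem_nhds_of_mem hy) hl'
    simpa [hM] using this
  · rw [closure_openBall_eq_paramBall hR]
    exact h.continuousOn_lossGrad.norm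

theorem inner_gradStep_sub (g' : EuclideanSpace ℝ (Fin d) → EuclideanSpace ℝ (Fin d))
    (x y : EuclideanSpace ℝ (Fin d)) :
    ⟪(x - η • g' x) - (y - η • g' y), x - y⟫ = ‖x - y‖ ^ 2 - η * ⟪x - y, g' x - g' y⟫ := by
  have : (x - η • g' x) - (y - η • g' y) = (x - y) - η • (g' x - g' y) := by
    rw [smul_sub]; abel
  rw [this, inner_sub_left, real_inner_smul_left, real_inner_self_eq_norm_sq,
    real_inner_comm (x - y)]

/-- The gradient step is itself a gradient, which brings it within reach of `norm_gradient_sub_le`.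
-/
theorem hasGradientAt_gradStep (h : IsSmoothLoss R L g) {x : EuclideanSpace ℝ (Fin d)}
    (hx : x ∈ ball (0 : EuclideanSpace ℝ (Fin d)) R) :
    HasGradientAt (fun x => ‖x‖ ^ 2 * 2⁻¹ - η * g x) (x - η • lossGrad R g x) x := by
  have h1 := (h.hasGradientAt_lossGrad hx).hasFDerivAt
  have h2 := (hasStrictFDerivAt_norm_sq x).hasFDerivAt
  rw [hasGradientAt_iff_hasFDerivAt]
  refine ((h2.mul_const (2⁻¹ : ℝ)).sub (h1.const_mul η)).congr_fderiv ?_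
  ext w
  simp

theorem norm_gradStep_sub_le_of_mem_ball (hη : 0 < η) (hηL : η * L ≤ 1)
    (hc : 0 ≤ 1 - η * m) (h : IsSmoothLoss R L g) (hs : IsStronglyConvexLoss R m g)
    {x y : EuclideanSpace ℝ (Fin d)} (hx : x ∈ ball (0 : EuclideanSpace ℝ (Fin d)) R)
    (hy : y ∈ ball (0 : EuclideanSpace ℝ (Fin d)) R) :
    ‖(x - η • lossGrad R g x) - (y - η • lossGrad R g y)‖ ≤ (1 - η * m) * ‖x - y‖ := by
  have hbb : ball (0 : EuclideanSpace ℝ (Fin d)) R ⊆ paramBall d R := ball_subset_closedBall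
  -- `norm_gradient_sub_le` requires a positive constant and `1 - η * m` may vanish; hence the
  -- detour through larger `c'`.
  have key : ∀ c' > 1 - η * m,
      ‖(x - η • lossGrad R g x) - (y - η • lossGrad R g y)‖ ≤ c' * ‖x - y‖ := by
    intro c' hc'
    refine norm_gradient_sub_le (G := fun x => x - η • lossGrad R g x) (convex_ball 0 R)
      isOpen_ball (hc.trans_lt hc') (fun z hz => hasGradientAt_gradStep h hz)
      (continuousOn_id.sub ((h.continuousOn_lossGrad.mono hbb).const_smul η)) ?_ ?_ hy hx
    -- Monotonicity is where `η * L ≤ 1` enters; strong convexity supplies the one-sided bound in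
    -- the next case.
    · intro z hz w hw
      rw [inner_gradStep_sub]
      have h1 : ⟪z - w, lossGrad R g z - lossGrad R g w⟫ ≤ L * ‖z - w‖ ^ 2 := by
        refine (real_inner_le_norm _ _).trans ?_
        have := mul_le_mul_of_nonneg_left (h.2 z (hbb hz) w (hbb hw)) (norm_nonneg (z - w))
        linarith
      have h2 := mul_le_mul_of_nonneg_left h1 hη.le
      have h3 := mul_le_mul_of_nonneg_right hηL (sq_nonneg ‖z - w‖)
      linarith
    · intro z hz w hw
      rw [inner_gradStep_sub]
      have h2 := mul_le_mul_of_nonneg_left (hs z (hbb hz) w (hbb hw)) hη.le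
      have h3 := mul_le_mul_of_nonneg_right hc'.le (sq_nonneg ‖z - w‖)
      linarith
  rcases (norm_nonneg (x - y)).eq_or_lt with h0 | h0
  · have := key (1 - η * m + 1) (by linarith)
    rwa [← h0, mul_zero] at this ⊢
  · rw [← div_le_iff₀ h0]
    refine le_of_forall_gt_imp_ge_of_dense fun c' hc' => ?_
    rw [div_le_iff₀ h0]
    exact key c' hc'

/-- A gradient step of size `η ≤ 1 / L` on a smooth strongly convex loss is a contraction of
the ball. -/
theorem norm_gradStep_sub_le (hR : 0 < R) (hη : 0 < η) (hηL : η * L ≤ 1) (hc : 0 ≤ 1 - η * m)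
    (h : IsSmoothLoss R L g) (hs : IsStronglyConvexLoss R m g) {x y : EuclideanSpace ℝ (Fin d)}
    (hx : x ∈ paramBall d R) (hy : y ∈ paramBall d R) :
    ‖(x - η • lossGrad R g x) - (y - η • lossGrad R g y)‖ ≤ (1 - η * m) * ‖x - y‖ := by
  have hGc : ContinuousOn (fun x => x - η • lossGrad R g x) (closure (ball 0 R)) := by
    rw [closure_openBall_eq_paramBall hR]
    exact continuousOn_id.sub (h.continuousOn_lossGrad.const_smul η)
  have hl : LipschitzOnWith (1 - η * m).toNNReal (fun x => x - η • lossGrad R g x)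
      (ball (0 : EuclideanSpace ℝ (Fin d)) R) := by
    refine LipschitzOnWith.of_dist_le_mul fun x hx y hy => ?_
    rw [dist_eq_norm, dist_eq_norm, Real.coe_toNNReal _ hc]
    exact norm_gradStep_sub_le_of_mem_ball hη hηL hc h hs hx hy
  rw [← lipschitzOnWith_closure_iff hGc, closure_openBall_eq_paramBall hR] at hl
  have := hl.dist_le_mul x hx y hy
  rwa [dist_eq_norm, dist_eq_norm, Real.coe_toNNReal _ hc] at this

/-- The smoothness constant dominates the strong convexity constant. -/
theorem strongConvexity_le_smoothness [Nonempty (Fin d)] (hR : 0 < R) (h : IsSmoothLoss R L g)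
    (hs : IsStronglyConvexLoss R m g) : m ≤ L := by
  obtain ⟨x, hx⟩ := NormedSpace.exists_lt_norm ℝ (EuclideanSpace ℝ (Fin d)) 0
  set y := (R / ‖x‖) • x with hy
  have hyn : ‖y‖ = R := by
    rw [hy, norm_smul, Real.norm_of_nonneg (by positivity)]; field_simp
  have hyb : y ∈ paramBall d R := mem_paramBall.2 hyn.le
  have h0 : (0 : EuclideanSpace ℝ (Fin d)) ∈ paramBall d R := mem_paramBall.2 (by simpa using hR.le)
  have h1 := (hs y hyb 0 h0).trans (real_inner_le_norm _ _)
  have h2 := mul_le_mul_of_nonneg_left (h.2 y hyb 0 h0) (norm_nonneg (y - 0))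
  rw [sub_zero, hyn] at h1 h2
  have : m * R ^ 2 ≤ L * R ^ 2 := by linarith
  exact le_of_mul_le_mul_right this (by positivity)

/-- A point of norm `R` exists only in positive dimension; in dimension zero every `M` is
admissible. -/
theorem IsLipschitzLoss.nonneg [Nonempty (Fin d)] (hR : 0 < R) (hl : IsLipschitzLoss R M g) :
    0 ≤ M := by
  obtain ⟨x, hx⟩ := NormedSpace.exists_lt_norm ℝ (EuclideanSpace ℝ (Fin d)) 0
  set y := (R / ‖x‖) • x with hy
  have hyn : ‖y‖ = R := by
    rw [hy, norm_smul, Real.norm_of_nonneg (by positivity)]; field_simp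
  have h0 : (0 : EuclideanSpace ℝ (Fin d)) ∈ paramBall d R := mem_paramBall.2 (by simpa using hR.le)
  have h1 := (abs_nonneg _).trans (hl y (mem_paramBall.2 hyn.le) 0 h0)
  rw [sub_zero, hyn] at h1
  exact nonneg_of_mul_nonneg_left h1 hR

end LossGradient

/-! ### The mini-batch step: contraction and sensitivity to one data point -/

section Drift

variable {X : Type*} {d n b : ℕ} {R L M m η : ℝ} {f : X → EuclideanSpace ℝ (Fin d) → ℝ}

/-- The noiseless gradient step on the mini-batch `S`. -/
def batchStep (R η : ℝ) (f : X → EuclideanSpace ℝ (Fin d) → ℝ) (b : ℕ) (D : Fin n → X)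
    (S : Finset (Fin n)) (x : EuclideanSpace ℝ (Fin d)) : EuclideanSpace ℝ (Fin d) :=
  x - η • batchGrad R f b D S x

theorem measurable_batchStep (hsmooth : ∀ z, IsSmoothLoss R L (f z)) (D : Fin n → X)
    (S : Finset (Fin n)) : Measurable (batchStep R η f b D S) := by
  have : ∀ z, Measurable (lossGrad R (f z)) := fun z => (hsmooth z).measurable_lossGrad
  unfold batchStep batchGrad
  fun_prop

/-- Since `S` has exactly `b` elements, the batch step is the average of one-point gradient steps,
each of which is a contraction. -/
theorem norm_batchStep_sub_le (hR : 0 < R) (hη : 0 < η) (hηL : η * L ≤ 1) (hc : 0 ≤ 1 - η * m)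
    (hsmooth : ∀ z, IsSmoothLoss R L (f z)) (hconv : ∀ z, IsStronglyConvexLoss R m (f z))
    (D : Fin n → X) {S : Finset (Fin n)} (hb : 0 < b) (hS : S.card = b)
    {x y : EuclideanSpace ℝ (Fin d)} (hx : x ∈ paramBall d R) (hy : y ∈ paramBall d R) :
    ‖batchStep R η f b D S x - batchStep R η f b D S y‖ ≤ (1 - η * m) * ‖x - y‖ := by
  have hb' : (b : ℝ) ≠ 0 := by positivity
  have e : ∀ x, batchStep R η f b D S x =
      (1 / (b : ℝ)) • ∑ i ∈ S, (x - η • lossGrad R (f (D i)) x) := by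
    intro x
    rw [batchStep, batchGrad, Finset.sum_sub_distrib, Finset.sum_const, hS, ← Finset.smul_sum,
      smul_sub, ← Nat.cast_smul_eq_nsmul ℝ, smul_smul, smul_smul, smul_smul, mul_comm η, one_div_mul_cancel hb',
      one_smul]
  rw [e, e, ← smul_sub, ← Finset.sum_sub_distrib, norm_smul,
    Real.norm_of_nonneg (by positivity)]
  have := norm_sum_le_of_le S fun i _ =>
    norm_gradStep_sub_le hR hη hηL hc (hsmooth (D i)) (hconv (D i)) hx hy
  rw [Finset.sum_const, hS, nsmul_eq_mul] at this
  calc _ ≤ 1 / (b : ℝ) * (b * ((1 - η * m) * ‖x - y‖)) := by gcongr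
    _ = _ := by field_simp

/-- Only the summand `i` changes: a difference of two gradients of norm at most `M`, with weight `η
/ b`. -/
theorem norm_batchStep_update_sub_le (hR : 0 < R) (hM : 0 ≤ M) (hη : 0 < η)
    (hsmooth : ∀ z, IsSmoothLoss R L (f z)) (hlip : ∀ z, IsLipschitzLoss R M (f z))
    (D : Fin n → X) (i : Fin n) (z : X) (S : Finset (Fin n))
    {x : EuclideanSpace ℝ (Fin d)} (hx : x ∈ paramBall d R) :
    ‖batchStep R η f b D S x - batchStep R η f b (Function.update D i z) S x‖ ≤
      if i ∈ S then 2 * η * M / b else 0 := by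
  have e : batchStep R η f b D S x - batchStep R η f b (Function.update D i z) S x =
      (η * (1 / (b : ℝ))) • ∑ k ∈ S, (lossGrad R (f (Function.update D i z k)) x -
        lossGrad R (f (D k)) x) := by
    rw [batchStep, batchStep, batchGrad, batchGrad, sub_sub_sub_cancel_left, ← smul_sub,
      ← smul_sub, ← Finset.sum_sub_distrib, smul_smul]
  rw [e]
  have h0 : ∀ k, k ≠ i → lossGrad R (f (Function.update D i z k)) x -
      lossGrad R (f (D k)) x = 0 := fun k hk => by rw [Function.update_of_ne hk, sub_self]
  split_ifs with hi
  · rw [Finset.sum_eq_single_of_mem i hi fun k _ hk => h0 k hk, norm_smul,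
      Real.norm_of_nonneg (by positivity)]
    have h2 := (norm_sub_le (lossGrad R (f (Function.update D i z i)) x) (lossGrad R (f (D i)) x)).trans
      (add_le_add (norm_lossGrad_le hR hM (hsmooth _) (hlip _) hx)
        (norm_lossGrad_le hR hM (hsmooth _) (hlip _) hx))
    calc _ ≤ η * (1 / (b : ℝ)) * (M + M) := by gcongr
      _ = _ := by ring
  · rw [Finset.sum_eq_zero fun k hk => h0 k (by rintro rfl; exact hi hk)]
    simp

end Drift

/-! ### Couplings at bounded distance and noisy steps -/

section Coupling

variable {d : ℕ} {R s δ δ' : ℝ}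

/-- There is a coupling of `μ` and `μ'` supported on pairs of points of the ball at distance at
most `δ`. For laws on the ball this says that their `W_∞` distance is at most `δ`. -/
def Coupled (R δ : ℝ) (μ μ' : Measure (EuclideanSpace ℝ (Fin d))) : Prop :=
  ∃ π : Measure (EuclideanSpace ℝ (Fin d) × EuclideanSpace ℝ (Fin d)), IsProbabilityMeasure π ∧
    π.map Prod.fst = μ ∧ π.map Prod.snd = μ' ∧
    ∀ᵐ p ∂π, p.1 ∈ paramBall d R ∧ p.2 ∈ paramBall d R ∧ ‖p.1 - p.2‖ ≤ δ

theorem measurableSet_coupled : MeasurableSet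
    {p : EuclideanSpace ℝ (Fin d) × EuclideanSpace ℝ (Fin d) |
      p.1 ∈ paramBall d R ∧ p.2 ∈ paramBall d R ∧ ‖p.1 - p.2‖ ≤ δ} := by
  have : MeasurableSet (paramBall d R) := measurableSet_paramBall
  have hm : Measurable fun p : EuclideanSpace ℝ (Fin d) × EuclideanSpace ℝ (Fin d) =>
      ‖p.1 - p.2‖ := by fun_prop
  exact (measurable_fst this).inter ((measurable_snd this).inter
    (measurableSet_le hm measurable_const))

theorem Coupled.mono {μ μ' : Measure (EuclideanSpace ℝ (Fin d))} (h : Coupled R δ μ μ')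
    (hδ : δ ≤ δ') : Coupled R δ' μ μ' := by
  obtain ⟨π, h1, h2, h3, h4⟩ := h
  exact ⟨π, h1, h2, h3, h4.mono fun p hp => ⟨hp.1, hp.2.1, hp.2.2.trans hδ⟩⟩

theorem Coupled.symm {μ μ' : Measure (EuclideanSpace ℝ (Fin d))} (h : Coupled R δ μ μ') :
    Coupled R δ μ' μ := by
  obtain ⟨π, h1, h2, h3, h4⟩ := h
  refine ⟨π.map Prod.swap, Measure.isProbabilityMeasure_map measurable_swap.aemeasurable, ?_, ?_, ?_⟩
  · rw [Measure.map_map measurable_fst measurable_swap]; exact h3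
  · rw [Measure.map_map measurable_snd measurable_swap]; exact h2
  · refine (ae_map_iff measurable_swap.aemeasurable measurableSet_coupled).2 ?_
    filter_upwards [h4] with p hp
    exact ⟨hp.2.1, hp.1, by rw [norm_sub_rev]; exact hp.2.2⟩

/-- The independent coupling suffices, two points of the ball being at most a diameter apart. This
is the source of `2R` in `Z`. -/
theorem Coupled.of_supported {μ μ' : Measure (EuclideanSpace ℝ (Fin d))}
    [IsProbabilityMeasure μ] [IsProbabilityMeasure μ'] (h : μ (paramBall d R)ᶜ = 0)
    (h' : μ' (paramBall d R)ᶜ = 0) : Coupled R (2 * R) μ μ' := by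
  refine ⟨μ.prod μ', inferInstance, by simp, by simp, ?_⟩
  have a1 : ∀ᵐ p ∂(μ.prod μ'), p.1 ∈ paramBall d R :=
    Measure.quasiMeasurePreserving_fst.ae (p := fun x => x ∈ paramBall d R) (mem_ae_iff.2 h)
  have a2 : ∀ᵐ p ∂(μ.prod μ'), p.2 ∈ paramBall d R :=
    Measure.quasiMeasurePreserving_snd.ae (p := fun x => x ∈ paramBall d R) (mem_ae_iff.2 h')
  filter_upwards [a1, a2] with p h1 h2
  refine ⟨h1, h2, (norm_sub_le _ _).trans ?_⟩
  linarith [mem_paramBall.1 h1, mem_paramBall.1 h2]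

/-- The law of `Π(T x + s W)` for independent `x ∼ μ` and `W ∼ N(0, I_d)`. -/
def noisyLaw (R s : ℝ) (T : EuclideanSpace ℝ (Fin d) → EuclideanSpace ℝ (Fin d))
    (μ : Measure (EuclideanSpace ℝ (Fin d))) : Measure (EuclideanSpace ℝ (Fin d)) :=
  (μ.prod (stdGaussian (EuclideanSpace ℝ (Fin d)))).map fun p => projBall R (T p.1 + s • p.2)

theorem measurable_noisyMap (hR : 0 ≤ R)
    {T : EuclideanSpace ℝ (Fin d) → EuclideanSpace ℝ (Fin d)} (hT : Measurable T) :
    Measurable fun p : EuclideanSpace ℝ (Fin d) × EuclideanSpace ℝ (Fin d) =>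
      projBall R (T p.1 + s • p.2) :=
  (continuous_projBall hR).measurable.comp
    ((hT.comp measurable_fst).add (measurable_snd.const_smul s))

theorem isProbabilityMeasure_noisyLaw (hR : 0 ≤ R)
    {T : EuclideanSpace ℝ (Fin d) → EuclideanSpace ℝ (Fin d)} (hT : Measurable T)
    (μ : Measure (EuclideanSpace ℝ (Fin d))) [IsProbabilityMeasure μ] :
    IsProbabilityMeasure (noisyLaw R s T μ) :=
  Measure.isProbabilityMeasure_map (measurable_noisyMap hR hT).aemeasurable

theorem noisyLaw_compl_paramBall (hR : 0 ≤ R)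
    {T : EuclideanSpace ℝ (Fin d) → EuclideanSpace ℝ (Fin d)} (hT : Measurable T)
    (μ : Measure (EuclideanSpace ℝ (Fin d))) :
    noisyLaw R s T μ (paramBall d R)ᶜ = 0 := by
  rw [noisyLaw, Measure.map_apply (measurable_noisyMap hR hT) measurableSet_paramBall.compl]
  have : (fun p : EuclideanSpace ℝ (Fin d) × EuclideanSpace ℝ (Fin d) =>
      projBall R (T p.1 + s • p.2)) ⁻¹' (paramBall d R)ᶜ = ∅ := by
    ext p; simp [projBall_mem hR]
  rw [this, measure_empty]

theorem map_fst_prod_eq {E G : Type*} [MeasurableSpace E] [MeasurableSpace G]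
    {π : Measure (E × E)} [IsProbabilityMeasure π] {γ : Measure G} [IsProbabilityMeasure γ]
    {h : E × E → E} (hh : Measurable h) :
    (π.prod γ).map (Prod.map h id) = (π.map h).prod γ := by
  have := Measure.map_prod_map π γ hh measurable_id
  rw [Measure.map_id] at this
  exact this.symm

/-- Synchronous coupling: both chains use the same noise. -/
theorem Coupled.noisy (hR : 0 ≤ R) {μ μ' : Measure (EuclideanSpace ℝ (Fin d))}
    (h : Coupled R δ μ μ') {T T' : EuclideanSpace ℝ (Fin d) → EuclideanSpace ℝ (Fin d)}
    (hT : Measurable T) (hT' : Measurable T')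
    (hTT' : ∀ x ∈ paramBall d R, ∀ y ∈ paramBall d R, ‖x - y‖ ≤ δ → ‖T x - T' y‖ ≤ δ') :
    Coupled R δ' (noisyLaw R s T μ) (noisyLaw R s T' μ') := by
  obtain ⟨π, h1, rfl, rfl, h4⟩ := h
  set γ := stdGaussian (EuclideanSpace ℝ (Fin d))
  have m1 := measurable_noisyMap (s := s) hR hT
  have m2 := measurable_noisyMap (s := s) hR hT'
  have f1 : Measurable (Prod.map Prod.fst id : (EuclideanSpace ℝ (Fin d) × EuclideanSpace ℝ (Fin d)) ×
    EuclideanSpace ℝ (Fin d) → _) := measurable_fst.prodMap measurable_id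
  have f2 : Measurable (Prod.map Prod.snd id : (EuclideanSpace ℝ (Fin d) × EuclideanSpace ℝ (Fin d)) ×
    EuclideanSpace ℝ (Fin d) → _) := measurable_snd.prodMap measurable_id
  have m12 := (m1.comp f1).prodMk (m2.comp f2)
  refine ⟨(π.prod γ).map _, Measure.isProbabilityMeasure_map m12.aemeasurable, ?_, ?_, ?_⟩
  · rw [Measure.map_map measurable_fst m12, noisyLaw, ← map_fst_prod_eq measurable_fst,
      Measure.map_map m1 f1]
    rfl
  · rw [Measure.map_map measurable_snd m12, noisyLaw, ← map_fst_prod_eq measurable_snd,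
      Measure.map_map m2 f2]
    rfl
  · refine (ae_map_iff m12.aemeasurable measurableSet_coupled).2 ?_
    have a1 := (Measure.quasiMeasurePreserving_fst (μ := π) (ν := γ)).ae h4
    filter_upwards [a1] with p hp
    refine ⟨projBall_mem hR _, projBall_mem hR _, (norm_projBall_sub_le hR _ _).trans ?_⟩
    simp only [Prod.map_fst, Prod.map_snd, add_sub_add_right_eq_sub]
    exact hTT' _ hp.1 _ hp.2.1 hp.2.2

end Coupling

/-! ### Propagation of couplings through epochs -/

section Epochs

variable {X : Type*} {d n b q : ℕ} {R η σ c e δ : ℝ} {f : X → EuclideanSpace ℝ (Fin d) → ℝ}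

theorem noisyStep_eq_noisyLaw (D : Fin n → X) (S : Finset (Fin n))
    (μ : Measure (EuclideanSpace ℝ (Fin d))) :
    noisyStep R η σ f b D S μ =
      noisyLaw R (Real.sqrt (2 * η * σ ^ 2)) (batchStep R η f b D S) μ := rfl

theorem epochLaw_zero (B : Fin 0 → Finset (Fin n)) (D : Fin n → X)
    (μ : Measure (EuclideanSpace ℝ (Fin d))) : epochLaw R η σ f b B D μ = μ := by
  simp [epochLaw]

theorem epochLaw_succ (B : Fin (q + 1) → Finset (Fin n)) (D : Fin n → X)
    (μ : Measure (EuclideanSpace ℝ (Fin d))) :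
    epochLaw R η σ f b B D μ = noisyStep R η σ f b D (B (Fin.last q))
      (epochLaw R η σ f b (fun j => B j.castSucc) D μ) := by
  simp [epochLaw, Fin.foldl_succ_last]

theorem isProbabilityMeasure_epochLaw (hR : 0 ≤ R)
    (hmeas : ∀ (D : Fin n → X) S, Measurable (batchStep R η f b D S))
    (B : Fin q → Finset (Fin n)) (D : Fin n → X)
    (μ : Measure (EuclideanSpace ℝ (Fin d))) [IsProbabilityMeasure μ] :
    IsProbabilityMeasure (epochLaw R η σ f b B D μ) := by
  induction q with
  | zero => rw [epochLaw_zero]; infer_instance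
  | succ q ih =>
    rw [epochLaw_succ, noisyStep_eq_noisyLaw]
    have := ih fun j => B j.castSucc
    exact isProbabilityMeasure_noisyLaw hR (hmeas _ _) _

theorem Coupled.epoch (hR : 0 ≤ R)
    (hmeas : ∀ (D : Fin n → X) S, Measurable (batchStep R η f b D S)) (hc : 0 ≤ c)
    (hT : ∀ (D : Fin n → X) (S : Finset (Fin n)), S.card = b → ∀ x ∈ paramBall d R,
      ∀ y ∈ paramBall d R, ‖batchStep R η f b D S x - batchStep R η f b D S y‖ ≤ c * ‖x - y‖)
    {B : Fin q → Finset (Fin n)} (hB : ∀ j, (B j).card = b) (D : Fin n → X)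
    {μ μ' : Measure (EuclideanSpace ℝ (Fin d))} (h : Coupled R δ μ μ') :
    Coupled R (c ^ q * δ) (epochLaw R η σ f b B D μ) (epochLaw R η σ f b B D μ') := by
  induction q with
  | zero => simpa [epochLaw_zero] using h
  | succ q ih =>
    rw [epochLaw_succ, epochLaw_succ, noisyStep_eq_noisyLaw, noisyStep_eq_noisyLaw]
    refine (ih (B := fun j => B j.castSucc) fun j => hB _).noisy hR (hmeas _ _) (hmeas _ _)
      fun x hx y hy hxy => (hT D _ (hB _) x hx y hy).trans ?_
    rw [pow_succ', mul_assoc]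
    gcongr

theorem Coupled.epochs (hR : 0 ≤ R)
    (hmeas : ∀ (D : Fin n → X) S, Measurable (batchStep R η f b D S)) (hc : 0 ≤ c)
    (hT : ∀ (D : Fin n → X) (S : Finset (Fin n)), S.card = b → ∀ x ∈ paramBall d R,
      ∀ y ∈ paramBall d R, ‖batchStep R η f b D S x - batchStep R η f b D S y‖ ≤ c * ‖x - y‖)
    {B : Fin q → Finset (Fin n)} (hB : ∀ j, (B j).card = b) (D : Fin n → X) (K : ℕ)
    {μ μ' : Measure (EuclideanSpace ℝ (Fin d))} (h : Coupled R δ μ μ') :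
    Coupled R ((c ^ q) ^ K * δ) (epochsLaw R η σ f b B K D μ) (epochsLaw R η σ f b B K D μ') := by
  induction K with
  | zero => simpa [epochsLaw] using h
  | succ K ih =>
    rw [pow_succ', mul_assoc, epochsLaw, epochsLaw, Function.iterate_succ_apply',
      Function.iterate_succ_apply']
    exact ih.epoch hR hmeas hc hT hB D

/-- The sum over batches frees the induction on `q` from the covering property, which initial
segments of the partition lack. Later contraction of the perturbation is discarded by `c ≤ 1`, so
the position of the batch containing `i` does not matter. -/
theorem Coupled.epoch_update (hR : 0 ≤ R)
    (hmeas : ∀ (D : Fin n → X) S, Measurable (batchStep R η f b D S)) (hc : 0 ≤ c) (hc1 : c ≤ 1)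
    (he : 0 ≤ e)
    (hT : ∀ (D : Fin n → X) (S : Finset (Fin n)), S.card = b → ∀ x ∈ paramBall d R,
      ∀ y ∈ paramBall d R, ‖batchStep R η f b D S x - batchStep R η f b D S y‖ ≤ c * ‖x - y‖)
    {D : Fin n → X} {i : Fin n} {z : X}
    (hD : ∀ S, ∀ x ∈ paramBall d R, ‖batchStep R η f b D S x -
      batchStep R η f b (Function.update D i z) S x‖ ≤ if i ∈ S then e else 0)
    {B : Fin q → Finset (Fin n)} (hB : ∀ j, (B j).card = b)
    {μ μ' : Measure (EuclideanSpace ℝ (Fin d))} (h : Coupled R δ μ μ') :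
    Coupled R (c ^ q * δ + ∑ j, if i ∈ B j then e else 0) (epochLaw R η σ f b B D μ)
      (epochLaw R η σ f b B (Function.update D i z) μ') := by
  induction q with
  | zero => simpa [epochLaw_zero] using h
  | succ q ih =>
    rw [epochLaw_succ, epochLaw_succ, noisyStep_eq_noisyLaw, noisyStep_eq_noisyLaw]
    refine (ih (B := fun j => B j.castSucc) fun j => hB _).noisy hR (hmeas _ _) (hmeas _ _)
      fun x hx y hy hxy => ?_
    have h1 := hT D _ (hB (Fin.last q)) x hx y hy
    have h2 := hD (B (Fin.last q)) y hy
    have h3 := norm_sub_le_norm_sub_add_norm_sub (batchStep R η f b D (B (Fin.last q)) x)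
      (batchStep R η f b D (B (Fin.last q)) y)
      (batchStep R η f b (Function.update D i z) (B (Fin.last q)) y)
    rw [Fin.sum_univ_castSucc, pow_succ', mul_assoc]
    set S := ∑ j : Fin q, if i ∈ B j.castSucc then e else 0
    have hS : 0 ≤ S := Finset.sum_nonneg fun j _ => by split_ifs <;> simp [he]
    have h4 : c * ‖x - y‖ ≤ c * (c ^ q * δ + S) := by gcongr
    have h5 : c * S ≤ S := mul_le_of_le_one_left hS hc1
    linarith

theorem IsMinibatchSequence.sum_ite_le {B : Fin q → Finset (Fin n)}
    (hB : IsMinibatchSequence b B) (i : Fin n) :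
    ∑ j, (if i ∈ B j then e else 0) ≤ e := by
  obtain ⟨j, hj⟩ := hB.cover i
  rw [Finset.sum_eq_single_of_mem j (Finset.mem_univ j), if_pos hj]
  intro k _ hk
  exact if_neg fun hi => (Finset.disjoint_left.1 (hB.disjoint k j hk) hi) hj

/-- Stationary laws of adjacent datasets are close in `W_∞`. -/
theorem coupled_stationary_update (hR : 0 ≤ R)
    (hmeas : ∀ (D : Fin n → X) S, Measurable (batchStep R η f b D S)) (hc : 0 ≤ c) (hc1 : c ≤ 1)
    (hq : c ^ q < 1) (he : 0 ≤ e)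
    (hT : ∀ (D : Fin n → X) (S : Finset (Fin n)), S.card = b → ∀ x ∈ paramBall d R,
      ∀ y ∈ paramBall d R, ‖batchStep R η f b D S x - batchStep R η f b D S y‖ ≤ c * ‖x - y‖)
    {D : Fin n → X} {i : Fin n} {z : X}
    (hD : ∀ S, ∀ x ∈ paramBall d R, ‖batchStep R η f b D S x -
      batchStep R η f b (Function.update D i z) S x‖ ≤ if i ∈ S then e else 0)
    {B : Fin q → Finset (Fin n)} (hB : IsMinibatchSequence b B)
    {ν ν' : Measure (EuclideanSpace ℝ (Fin d))} (hν : IsStationaryLaw R η σ f b B D ν)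
    (hν' : IsStationaryLaw R η σ f b B (Function.update D i z) ν') (k : ℕ) :
    Coupled R ((c ^ q) ^ k * (2 * R) + 1 / (1 - c ^ q) * e) ν ν' := by
  have := hν.isProbabilityMeasure
  have := hν'.isProbabilityMeasure
  have hq' : 0 < 1 - c ^ q := by linarith
  induction k with
  | zero =>
    refine (Coupled.of_supported hν.supported hν'.supported).mono ?_
    have : 0 ≤ 1 / (1 - c ^ q) * e := by positivity
    simpa using this
  | succ k ih =>
    -- By invariance an epoch reproduces the pair `ν`, `ν'`, so the bound can be iterated under `δ ↦
    -- c ^ q * δ + e`, whose fixed point is `e / (1 - c ^ q)`.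
    have := ih.epoch_update (σ := σ) hR hmeas hc hc1 he hT hD hB.card_eq
    rw [hν.invariant, hν'.invariant] at this
    refine this.mono ((add_le_add_right (hB.sum_ite_le i) _).trans (le_of_eq ?_))
    rw [pow_succ']
    field_simp
    ring

end Epochs

/-! ### Densities and moments of translated Gaussians -/

section GaussianShift

/-- It suffices to test boxes: their indicators factor over the coordinates, and independence of the
coordinates splits the integral. -/
theorem withDensity_pi_prod {ι : Type*} [Fintype ι] {Ω : ι → Type*} [∀ i, MeasurableSpace (Ω i)]
    (μ : ∀ i, Measure (Ω i)) [∀ i, IsProbabilityMeasure (μ i)] {h : ∀ i, Ω i → ℝ≥0∞}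
    (hh : ∀ i, Measurable (h i)) [∀ i, SigmaFinite ((μ i).withDensity (h i))] :
    Measure.pi (fun i => (μ i).withDensity (h i)) =
      (Measure.pi μ).withDensity fun x => ∏ i, h i (x i) := by
  refine Measure.pi_eq fun s hs => ?_
  rw [withDensity_apply _ (MeasurableSet.univ_pi hs),
    ← lintegral_indicator (MeasurableSet.univ_pi hs)]
  have hm : ∀ i, Measurable ((s i).indicator (h i)) := fun i => (hh i).indicator (hs i)
  have e : (Set.univ.pi s).indicator (fun x => ∏ i, h i (x i)) =
      fun x => ∏ i, (s i).indicator (h i) (x i) := by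
    classical
    funext x
    by_cases hx : x ∈ Set.univ.pi s
    · rw [Set.indicator_of_mem hx]
      exact Finset.prod_congr rfl fun i _ => (Set.indicator_of_mem (hx i trivial) _).symm
    · rw [Set.indicator_of_notMem hx]
      simp only [Set.mem_univ_pi, not_forall] at hx
      obtain ⟨i, hi⟩ := hx
      exact (Finset.prod_eq_zero (Finset.mem_univ i) (Set.indicator_of_notMem hi _)).symm
  rw [e]
  refine (lintegral_prod_eq_prod_lintegral_of_indepFun Finset.univ
    (fun i (x : ∀ i, Ω i) => (s i).indicator (h i) (x i))
    (iIndepFun_pi fun i => (hm i).aemeasurable) fun i =>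
      (hm i).comp (measurable_pi_apply i)).trans ?_
  refine Finset.prod_congr rfl fun i _ => ?_
  rw [withDensity_apply _ (hs i), ← lintegral_indicator (hs i)]
  exact (measurePreserving_eval μ i).lintegral_comp (hm i)

theorem gaussianReal_map_add_eq_withDensity (v : ℝ) :
    (gaussianReal 0 1).map (· + v) =
      (gaussianReal 0 1).withDensity fun x => ENNReal.ofReal (Real.exp (v * x - v ^ 2 / 2)) := by
  rw [gaussianReal_map_add_const, zero_add, gaussianReal_of_var_ne_zero _ one_ne_zero,
    gaussianReal_of_var_ne_zero _ one_ne_zero,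
    ← withDensity_mul _ (measurable_gaussianPDF 0 1) (by fun_prop)]
  congr 1
  funext x
  rw [Pi.mul_apply, gaussianPDF, gaussianPDF, ← ENNReal.ofReal_mul (gaussianPDFReal_nonneg _ _ _),
    gaussianPDFReal, gaussianPDFReal, mul_assoc _ (Real.exp _) (Real.exp _), ← Real.exp_add]
  congr 3
  simp only [NNReal.coe_one]
  ring

variable {d : ℕ}

/-- The density of a translate of the standard Gaussian measure. -/
theorem stdGaussian_map_add_eq_withDensity (v : EuclideanSpace ℝ (Fin d)) :
    (stdGaussian (EuclideanSpace ℝ (Fin d))).map (· + v) =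
      (stdGaussian (EuclideanSpace ℝ (Fin d))).withDensity
        fun w => ENNReal.ofReal (Real.exp (⟪v, w⟫ - ‖v‖ ^ 2 / 2)) := by
  have hlp : Measurable (WithLp.toLp 2 : (Fin d → ℝ) → EuclideanSpace ℝ (Fin d)) := by fun_prop
  have hρ : Measurable fun w : EuclideanSpace ℝ (Fin d) =>
      ENNReal.ofReal (Real.exp (⟪v, w⟫ - ‖v‖ ^ 2 / 2)) := by fun_prop
  have hadd : Measurable fun x : EuclideanSpace ℝ (Fin d) => x + v := by fun_prop
  have hadd' : Measurable fun (x : Fin d → ℝ) i => x i + v i := by fun_prop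
  have hsf : ∀ i, SigmaFinite ((gaussianReal 0 1).withDensity
      fun x => ENNReal.ofReal (Real.exp (v i * x - v i ^ 2 / 2))) := fun i => by
    rw [← gaussianReal_map_add_eq_withDensity, gaussianReal_map_add_const]; infer_instance
  have hsf' : ∀ i, SigmaFinite ((gaussianReal 0 1).map (· + v i)) := fun i => by
    rw [gaussianReal_map_add_const]; infer_instance
  rw [← map_pi_eq_stdGaussian, Measure.map_map hadd hlp]
  have e1 : (fun x : EuclideanSpace ℝ (Fin d) => x + v) ∘ WithLp.toLp 2 =
      WithLp.toLp 2 ∘ fun (x : Fin d → ℝ) i => x i + v i := by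
    funext x; ext i; simp
  rw [e1, ← Measure.map_map hlp hadd',
    Measure.pi_map_pi (f := fun i x => x + v i) (fun i => (measurable_add_const (v i)).aemeasurable)]
  simp_rw [gaussianReal_map_add_eq_withDensity]
  rw [withDensity_pi_prod _ (fun i => by fun_prop)]
  ext s hs
  rw [Measure.map_apply hlp hs, withDensity_apply _ (hlp hs), withDensity_apply _ hs,
    setLIntegral_map hs hρ hlp]
  refine lintegral_congr fun x => ?_
  rw [← ENNReal.ofReal_prod_of_nonneg fun i _ => (Real.exp_pos _).le, ← Real.exp_sum,
    Finset.sum_sub_distrib, ← Finset.sum_div, EuclideanSpace.real_norm_sq_eq, PiLp.inner_apply]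
  simp [mul_comm]

theorem lintegral_stdGaussian_add {h : EuclideanSpace ℝ (Fin d) → ℝ≥0∞} (hh : Measurable h)
    (v : EuclideanSpace ℝ (Fin d)) :
    ∫⁻ w, h (w + v) ∂(stdGaussian (EuclideanSpace ℝ (Fin d))) =
      ∫⁻ w, ENNReal.ofReal (Real.exp (⟪v, w⟫ - ‖v‖ ^ 2 / 2)) * h w
        ∂(stdGaussian (EuclideanSpace ℝ (Fin d))) := by
  have hρ : Measurable fun w : EuclideanSpace ℝ (Fin d) =>
      ENNReal.ofReal (Real.exp (⟪v, w⟫ - ‖v‖ ^ 2 / 2)) := by fun_prop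
  rw [← lintegral_map (f := h) (g := fun w => w + v) hh (by fun_prop),
    stdGaussian_map_add_eq_withDensity,
    lintegral_withDensity_eq_lintegral_mul _ hρ hh]
  rfl

/-- Completing the square: the `α`-th power of the density for `v` is a constant times the density
for `α • v`, which has mass one. -/
theorem lintegral_shiftDensity_rpow (v : EuclideanSpace ℝ (Fin d)) (α : ℝ) :
    ∫⁻ w, ENNReal.ofReal (Real.exp (⟪v, w⟫ - ‖v‖ ^ 2 / 2)) ^ α
        ∂(stdGaussian (EuclideanSpace ℝ (Fin d))) =
      ENNReal.ofReal (Real.exp (α * (α - 1) * ‖v‖ ^ 2 / 2)) := by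
  have h1 := lintegral_stdGaussian_add (h := fun _ => 1) measurable_const (α • v)
  simp only [lintegral_const, measure_univ, mul_one] at h1
  have e : ∀ w : EuclideanSpace ℝ (Fin d),
      ENNReal.ofReal (Real.exp (⟪v, w⟫ - ‖v‖ ^ 2 / 2)) ^ α =
      ENNReal.ofReal (Real.exp (α * (α - 1) * ‖v‖ ^ 2 / 2)) *
        ENNReal.ofReal (Real.exp (⟪α • v, w⟫ - ‖α • v‖ ^ 2 / 2)) := by
    intro w
    rw [ENNReal.ofReal_rpow_of_pos (Real.exp_pos _), ← ENNReal.ofReal_mul (Real.exp_pos _).le,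
      ← Real.exp_mul, ← Real.exp_add, real_inner_smul_left, norm_smul, mul_pow, Real.norm_eq_abs,
      sq_abs]
    congr 2
    ring
  simp_rw [e]
  rw [lintegral_const_mul _ (by fun_prop), ← h1, mul_one]

/-- The density of the image of `π ⊗ N(0, I)` under `(p, w) ↦ (p, w + V p)`. -/
def shiftDensity {Ω : Type*} (V : Ω → EuclideanSpace ℝ (Fin d))
    (z : Ω × EuclideanSpace ℝ (Fin d)) : ℝ≥0∞ :=
  ENNReal.ofReal (Real.exp (⟪V z.1, z.2⟫ - ‖V z.1‖ ^ 2 / 2))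

theorem measurable_shiftDensity {Ω : Type*} [MeasurableSpace Ω]
    {V : Ω → EuclideanSpace ℝ (Fin d)} (hV : Measurable V) : Measurable (shiftDensity V) := by
  have h1 : Measurable fun z : Ω × EuclideanSpace ℝ (Fin d) => V z.1 := hV.comp measurable_fst
  have h2 : Measurable fun z : Ω × EuclideanSpace ℝ (Fin d) => ⟪V z.1, z.2⟫ :=
    h1.inner measurable_snd
  unfold shiftDensity
  fun_prop

/-- Over each fixed `p` this is a translation of the Gaussian by the constant `V p`; Tonelli
assembles the fibres. -/
theorem map_shift_prod_stdGaussian {Ω : Type*} [MeasurableSpace Ω] (π : Measure Ω) [SFinite π]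
    {V : Ω → EuclideanSpace ℝ (Fin d)} (hV : Measurable V) :
    (π.prod (stdGaussian (EuclideanSpace ℝ (Fin d)))).map (fun z => (z.1, z.2 + V z.1)) =
      (π.prod (stdGaussian (EuclideanSpace ℝ (Fin d)))).withDensity (shiftDensity V) := by
  have hm : Measurable fun z : Ω × EuclideanSpace ℝ (Fin d) => (z.1, z.2 + V z.1) :=
    measurable_fst.prodMk (measurable_snd.add (hV.comp measurable_fst))
  ext A hA
  have hA1 : Measurable (A.indicator (1 : Ω × EuclideanSpace ℝ (Fin d) → ℝ≥0∞)) :=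
    measurable_one.indicator hA
  rw [← lintegral_indicator_one hA, lintegral_map hA1 hm, withDensity_apply _ hA,
    ← lintegral_indicator hA]
  have e : A.indicator (shiftDensity V) = fun z => shiftDensity V z * A.indicator 1 z := by
    funext z
    by_cases hz : z ∈ A <;> simp [hz]
  rw [e, lintegral_prod (fun z => A.indicator 1 (z.1, z.2 + V z.1)) (hA1.comp hm).aemeasurable,
    lintegral_prod (fun z => shiftDensity V z * A.indicator 1 z)
      ((measurable_shiftDensity hV).mul hA1).aemeasurable]
  refine lintegral_congr fun p => ?_
  exact lintegral_stdGaussian_add (h := fun w => A.indicator 1 (p, w))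
    (hA1.comp measurable_prodMk_left) (V p)

theorem lintegral_shiftDensity_prod_rpow_le {Ω : Type*} [MeasurableSpace Ω] (π : Measure Ω)
    [IsProbabilityMeasure π] {V : Ω → EuclideanSpace ℝ (Fin d)} (hV : Measurable V) {α ε : ℝ}
    (hα : 1 < α) (hε : ∀ᵐ p ∂π, ‖V p‖ ^ 2 ≤ ε) :
    ∫⁻ z, shiftDensity V z ^ α ∂(π.prod (stdGaussian (EuclideanSpace ℝ (Fin d)))) ≤
      ENNReal.ofReal (Real.exp (α * (α - 1) * ε / 2)) := by
  have hα0 : 0 ≤ α * (α - 1) := mul_nonneg (by linarith) (by linarith)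
  rw [lintegral_prod _ ((measurable_shiftDensity hV).pow_const α).aemeasurable]
  calc _ = ∫⁻ p, ENNReal.ofReal (Real.exp (α * (α - 1) * ‖V p‖ ^ 2 / 2)) ∂π :=
        lintegral_congr fun p => lintegral_shiftDensity_rpow (V p) α
    _ ≤ ∫⁻ _, ENNReal.ofReal (Real.exp (α * (α - 1) * ε / 2)) ∂π := by
        refine lintegral_mono_ae ?_
        filter_upwards [hε] with p hp
        gcongr
    _ = _ := by simp

end GaussianShift

/-! ### Data processing inequality -/

section DataProcessing

open Filter Topology

/-- Data processing: the Rényi moment does not increase under a measurable map. -/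
theorem lintegral_rnDeriv_map_rpow_le {Ω E : Type*} [MeasurableSpace Ω] [MeasurableSpace E]
    {Q : Measure Ω} [IsFiniteMeasure Q] {r : Ω → ℝ≥0∞} (hr : Measurable r)
    [IsFiniteMeasure (Q.withDensity r)] {G : Ω → E} (hG : Measurable G) {α : ℝ} (hα : 1 < α) :
    ∫⁻ x, (((Q.withDensity r).map G).rnDeriv (Q.map G) x) ^ α ∂(Q.map G) ≤ ∫⁻ ω, r ω ^ α ∂Q := by
  set Q' := Q.map G
  set P' := (Q.withDensity r).map G
  have hac : P' ≪ Q' := (withDensity_absolutelyContinuous Q r).map hG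
  set r' := P'.rnDeriv Q'
  have hr' : Measurable r' := Measure.measurable_rnDeriv _ _
  set A := ∫⁻ ω, r ω ^ α ∂Q
  have hα0 : 0 < α := by linarith
  have hpq : α.HolderConjugate (α.conjExponent) := Real.HolderConjugate.conjExponent hα
  have hβ : (α - 1) * α.conjExponent = α := by
    rw [Real.conjExponent]; field_simp [sub_ne_zero.2 hα.ne']
  have key : ∀ k : ℕ, ∫⁻ x, min (r' x) k ^ α ∂Q' ≤ A := by
    intro k
    -- Truncation makes `I` finite, so that a power of it can be cancelled after Hölder; monotone
    -- convergence removes the truncation.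
    set t : E → ℝ≥0∞ := fun x => min (r' x) k
    have ht : Measurable t := hr'.min measurable_const
    have htk : ∀ x, t x ≤ k := fun x => min_le_right _ _
    set I := ∫⁻ x, t x ^ α ∂Q' with hI
    have hItop : I ≠ ⊤ := by
      have : I ≤ ∫⁻ _, (k : ℝ≥0∞) ^ α ∂Q' :=
        lintegral_mono fun x => ENNReal.rpow_le_rpow (htk x) hα0.le
      refine ne_top_of_le_ne_top ?_ this
      rw [lintegral_const]
      exact ENNReal.mul_ne_top (ENNReal.rpow_ne_top_of_nonneg hα0.le (ENNReal.natCast_ne_top k))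
        (measure_ne_top _ _)
    have h1 : I ≤ ∫⁻ x, r' x * t x ^ (α - 1) ∂Q' := by
      refine lintegral_mono fun x => ?_
      calc t x ^ α = t x ^ (1 + (α - 1)) := by congr 1; ring
        _ = t x * t x ^ (α - 1) := by
          rw [ENNReal.rpow_add_of_nonneg _ _ zero_le_one (by linarith), ENNReal.rpow_one]
        _ ≤ r' x * t x ^ (α - 1) := by gcongr; exact min_le_left _ _
    -- The factor `r'` pulls back to `r`, because the other factor depends on `ω` only through `G`.
    have h2 : ∫⁻ x, r' x * t x ^ (α - 1) ∂Q' = ∫⁻ ω, r ω * t (G ω) ^ (α - 1) ∂Q := by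
      rw [lintegral_rnDeriv_mul hac (ht.pow_const _).aemeasurable,
        lintegral_map (ht.pow_const _) hG]
      exact lintegral_withDensity_eq_lintegral_mul _ hr ((ht.pow_const (α - 1)).comp hG)
    have h3 := ENNReal.lintegral_mul_le_Lp_mul_Lq Q hpq hr.aemeasurable
      ((ht.pow_const (α - 1)).comp hG).aemeasurable
    have h4 : ∫⁻ ω, ((fun x => t x ^ (α - 1)) ∘ G) ω ^ α.conjExponent ∂Q = I := by
      rw [hI, lintegral_map (ht.pow_const _) hG]
      refine lintegral_congr fun ω => ?_
      rw [Function.comp_apply, ← ENNReal.rpow_mul, hβ]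
    rw [h4] at h3
    have h5 : I ≤ A ^ (1 / α) * I ^ (1 / α.conjExponent) := h1.trans (h2.trans_le h3)
    rcases eq_or_ne I 0 with h0 | h0
    · rw [h0]; exact zero_le
    have h6 : I ^ (1 / α) * I ^ (1 / α.conjExponent) = I := by
      rw [← ENNReal.rpow_add _ _ h0 hItop, one_div, one_div, hpq.inv_add_inv_eq_one,
        ENNReal.rpow_one]
    have h7 : I ^ (1 / α) ≤ A ^ (1 / α) := by
      refine (ENNReal.mul_le_mul_iff_left (c := I ^ (1 / α.conjExponent)) ?_ ?_).1 (h6.trans_le h5)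
      · exact (ENNReal.rpow_pos (pos_iff_ne_zero.2 h0) hItop).ne'
      · exact ENNReal.rpow_ne_top_of_nonneg (one_div_nonneg.2 hpq.symm.nonneg) hItop
    exact (ENNReal.rpow_le_rpow_iff (one_div_pos.2 hα0)).1 h7
  have hlim : Tendsto (fun k : ℕ => ∫⁻ x, min (r' x) k ^ α ∂Q') atTop
      (𝓝 (∫⁻ x, r' x ^ α ∂Q')) := by
    refine lintegral_tendsto_of_tendsto_of_monotone
      (fun k => ((hr'.min measurable_const).pow_const _).aemeasurable) (ae_of_all _ ?_)
      (ae_of_all _ ?_)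
    · intro x i j hij
      refine ENNReal.rpow_le_rpow (min_le_min_left _ ?_) hα0.le
      exact_mod_cast hij
    · intro x
      have h1 : Tendsto (fun k : ℕ => min (r' x) (k : ℝ≥0∞)) atTop (𝓝 (min (r' x) ⊤)) :=
        tendsto_const_nhds.min ENNReal.tendsto_nat_nhds_top
      rw [min_top_right] at h1
      exact (ENNReal.continuous_rpow_const.tendsto _).comp h1
  exact le_of_tendsto' hlim key

end DataProcessing

/-! ### From coupling distance to Rényi divergence in one noisy step -/

section RenyiStep

variable {d : ℕ} {R s δ α : ℝ}

theorem renyiDiv_le_of_lintegral_le {E : Type*} [MeasurableSpace E] {μ ν : Measure E} {κ : ℝ}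
    (hα : 1 < α) (hac : μ ≪ ν)
    (h : ∫⁻ x, (μ.rnDeriv ν x) ^ α ∂ν ≤ ENNReal.ofReal (Real.exp ((α - 1) * κ))) :
    renyiDiv α μ ν ≤ (κ : EReal) := by
  have h0 : 0 < α - 1 := by linarith
  rw [renyiDiv, if_pos hac]
  have h1 : ENNReal.log (∫⁻ x, (μ.rnDeriv ν x) ^ α ∂ν) ≤ (((α - 1) * κ : ℝ) : EReal) := by
    refine (ENNReal.log_monotone h).trans (le_of_eq ?_)
    rw [ENNReal.log_ofReal_of_pos (Real.exp_pos _), Real.log_exp]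
  calc _ ≤ ((1 / (α - 1) : ℝ) : EReal) * (((α - 1) * κ : ℝ) : EReal) :=
        mul_le_mul_of_nonneg_left h1 (by exact_mod_cast (one_div_pos.2 h0).le)
    _ = (κ : EReal) := by
        rw [← EReal.coe_mul]; congr 1; field_simp

/-- One noisy step turns a `W_∞` bound into a Rényi divergence bound. -/
theorem renyiDiv_noisyLaw_le (hR : 0 ≤ R) (hs : 0 < s) (hα : 1 < α)
    {T : EuclideanSpace ℝ (Fin d) → EuclideanSpace ℝ (Fin d)} (hT : Measurable T)
    {π : Measure (EuclideanSpace ℝ (Fin d) × EuclideanSpace ℝ (Fin d))} [IsProbabilityMeasure π]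
    (hπ : ∀ᵐ p ∂π, ‖T p.1 - T p.2‖ ≤ δ) :
    renyiDiv α (noisyLaw R s T (π.map Prod.fst)) (noisyLaw R s T (π.map Prod.snd)) ≤
      ((α * δ ^ 2 / (2 * s ^ 2) : ℝ) : EReal) := by
  have hm := measurable_noisyMap (s := s) hR hT
  have f1 : Measurable (Prod.map Prod.fst id : (EuclideanSpace ℝ (Fin d) × EuclideanSpace ℝ (Fin d)) ×
    EuclideanSpace ℝ (Fin d) → _) := measurable_fst.prodMap measurable_id
  have f2 : Measurable (Prod.map Prod.snd id : (EuclideanSpace ℝ (Fin d) × EuclideanSpace ℝ (Fin d)) ×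
    EuclideanSpace ℝ (Fin d) → _) := measurable_snd.prodMap measurable_id
  -- Shifting the noise by `V p` moves the update of `p.2` onto that of `p.1`, so both laws become
  -- images under one map of `π ⊗ N(0, I)`, with and without a density.
  obtain ⟨V, hV⟩ : ∃ V : EuclideanSpace ℝ (Fin d) × EuclideanSpace ℝ (Fin d) →
      EuclideanSpace ℝ (Fin d), V = fun p => s⁻¹ • (T p.1 - T p.2) := ⟨_, rfl⟩
  have hVm : Measurable V := by
    rw [hV]
    exact ((hT.comp measurable_fst).sub (hT.comp measurable_snd)).const_smul s⁻¹
  have hshift : Measurable fun z : (EuclideanSpace ℝ (Fin d) × EuclideanSpace ℝ (Fin d)) ×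
      EuclideanSpace ℝ (Fin d) => (z.1, z.2 + V z.1) :=
    measurable_fst.prodMk (measurable_snd.add (hVm.comp measurable_fst))
  have eQ : noisyLaw R s T (π.map Prod.snd) =
      (π.prod (stdGaussian (EuclideanSpace ℝ (Fin d)))).map
        ((fun p => projBall R (T p.1 + s • p.2)) ∘ Prod.map Prod.snd id) := by
    rw [noisyLaw, ← map_fst_prod_eq measurable_snd, Measure.map_map hm f2]
  have eP : noisyLaw R s T (π.map Prod.fst) =
      ((π.prod (stdGaussian (EuclideanSpace ℝ (Fin d)))).withDensity (shiftDensity V)).map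
        ((fun p => projBall R (T p.1 + s • p.2)) ∘ Prod.map Prod.snd id) := by
    rw [noisyLaw, ← map_fst_prod_eq measurable_fst, Measure.map_map hm f1,
      ← map_shift_prod_stdGaussian π hVm, Measure.map_map (hm.comp f2) hshift]
    congr 1
    funext z
    have : T z.1.2 + s • (z.2 + V z.1) = T z.1.1 + s • z.2 := by
      rw [hV, smul_add, smul_smul, mul_inv_cancel₀ hs.ne', one_smul]; abel
    simp only [Function.comp_apply, Prod.map_fst, Prod.map_snd, id_eq, this]
  have hfin : IsFiniteMeasure
      ((π.prod (stdGaussian (EuclideanSpace ℝ (Fin d)))).withDensity (shiftDensity V)) := by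
    rw [← map_shift_prod_stdGaussian π hVm]
    infer_instance
  rw [eP, eQ]
  refine renyiDiv_le_of_lintegral_le hα
    ((withDensity_absolutelyContinuous _ _).map (hm.comp f2)) ?_
  refine (lintegral_rnDeriv_map_rpow_le (measurable_shiftDensity hVm) (hm.comp f2) hα).trans ?_
  refine (lintegral_shiftDensity_prod_rpow_le π hVm hα (ε := (s⁻¹ * δ) ^ 2) ?_).trans (le_of_eq ?_)
  · filter_upwards [hπ] with p hp
    rw [hV, norm_smul, Real.norm_of_nonneg (by positivity)]
    gcongr
  · congr 2
    field_simp

/-- The Rényi difference bound for one noisy step between coupled laws. -/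
theorem Coupled.renyiDiff_noisyLaw_le {c : ℝ} (hR : 0 ≤ R) (hs : 0 < s) (hα : 1 < α) (hc : 0 ≤ c)
    {T : EuclideanSpace ℝ (Fin d) → EuclideanSpace ℝ (Fin d)} (hT : Measurable T)
    (hTc : ∀ x ∈ paramBall d R, ∀ y ∈ paramBall d R, ‖T x - T y‖ ≤ c * ‖x - y‖)
    {μ μ' : Measure (EuclideanSpace ℝ (Fin d))} (h : Coupled R δ μ μ') :
    renyiDiff α (noisyLaw R s T μ) (noisyLaw R s T μ') ≤
      ((α * (c * δ) ^ 2 / (2 * s ^ 2) : ℝ) : EReal) := by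
  have key : ∀ μ μ' : Measure (EuclideanSpace ℝ (Fin d)), Coupled R δ μ μ' →
      renyiDiv α (noisyLaw R s T μ) (noisyLaw R s T μ') ≤
        ((α * (c * δ) ^ 2 / (2 * s ^ 2) : ℝ) : EReal) := by
    rintro _ _ ⟨π, h1, rfl, rfl, h4⟩
    refine renyiDiv_noisyLaw_le hR hs hα hT ?_
    filter_upwards [h4] with p hp
    exact (hTc _ hp.1 _ hp.2.1).trans (by gcongr; exact hp.2.2)
  exact max_le (key _ _ h) (key _ _ h.symm)

end RenyiStep

/-! ### Existence and uniqueness of the stationary law -/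

section Stationary

open Filter Topology

/-- The character `x ↦ exp(i⟪x, t⟫)` is `‖t‖`-Lipschitz. Letting `δ → 0` thus identifies laws
without the construction of a limiting coupling. -/
theorem Coupled.norm_charFun_sub_le {d : ℕ} {R δ : ℝ} {μ μ' : Measure (EuclideanSpace ℝ (Fin d))}
    (h : Coupled R δ μ μ') (t : EuclideanSpace ℝ (Fin d)) :
    ‖charFun μ t - charFun μ' t‖ ≤ δ * ‖t‖ := by
  obtain ⟨π, h1, rfl, rfl, h4⟩ := h
  have hm : Measurable fun x : EuclideanSpace ℝ (Fin d) => Complex.exp (⟪x, t⟫ * Complex.I) := by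
    fun_prop
  have hn : ∀ x : EuclideanSpace ℝ (Fin d), ‖Complex.exp (⟪x, t⟫ * Complex.I)‖ = 1 := fun x =>
    Complex.norm_exp_ofReal_mul_I _
  rw [charFun_apply, charFun_apply,
    integral_map measurable_fst.aemeasurable hm.aestronglyMeasurable,
    integral_map measurable_snd.aemeasurable hm.aestronglyMeasurable, ← integral_sub]
  · refine (norm_integral_le_of_norm_le_const (C := δ * ‖t‖) ?_).trans (by simp)
    filter_upwards [h4] with p hp
    have e : Complex.exp (⟪p.1, t⟫ * Complex.I) - Complex.exp (⟪p.2, t⟫ * Complex.I) =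
        Complex.exp (⟪p.2, t⟫ * Complex.I) *
          (Complex.exp (Complex.I * (⟪p.1 - p.2, t⟫ : ℝ)) - 1) := by
      rw [mul_sub, ← Complex.exp_add, mul_one, inner_sub_left]
      push_cast
      congr 2
      ring
    rw [e, norm_mul, hn, one_mul]
    refine (Real.norm_exp_I_mul_ofReal_sub_one_le).trans ((norm_inner_le_norm _ _).trans ?_)
    gcongr
    exact hp.2.2
  · exact Integrable.of_bound (hm.comp measurable_fst).aestronglyMeasurable 1
      (ae_of_all _ fun p => (hn p.1).le)
  · exact Integrable.of_bound (hm.comp measurable_snd).aestronglyMeasurable 1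
      (ae_of_all _ fun p => (hn p.2).le)

theorem tendsto_charFun_of_tendsto {d : ℕ} {ι : Type*} {l : Filter ι}
    {u : ι → ProbabilityMeasure (EuclideanSpace ℝ (Fin d))}
    {μ : ProbabilityMeasure (EuclideanSpace ℝ (Fin d))} (h : Tendsto u l (𝓝 μ))
    (t : EuclideanSpace ℝ (Fin d)) :
    Tendsto (fun i => charFun (u i : Measure (EuclideanSpace ℝ (Fin d))) t) l
      (𝓝 (charFun (μ : Measure (EuclideanSpace ℝ (Fin d))) t)) := by
  rw [ProbabilityMeasure.tendsto_iff_forall_integral_rclike_tendsto ℂ] at h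
  simp_rw [charFun_eq_integral_innerProbChar]
  exact h (BoundedContinuousFunction.innerProbChar t)

variable {X : Type*} {d n b q : ℕ} {R η σ c : ℝ} {f : X → EuclideanSpace ℝ (Fin d) → ℝ}

theorem IsStationaryLaw.iterate {B : Fin q → Finset (Fin n)} {D : Fin n → X}
    {ν : Measure (EuclideanSpace ℝ (Fin d))} (h : IsStationaryLaw R η σ f b B D ν) (K : ℕ) :
    epochsLaw R η σ f b B K D ν = ν :=
  Function.iterate_fixed h.invariant K

theorem IsStationaryLaw.unique (hR : 0 ≤ R)
    (hmeas : ∀ (D : Fin n → X) S, Measurable (batchStep R η f b D S)) (hc : 0 ≤ c)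
    (hq : c ^ q < 1)
    (hT : ∀ (D : Fin n → X) (S : Finset (Fin n)), S.card = b → ∀ x ∈ paramBall d R,
      ∀ y ∈ paramBall d R, ‖batchStep R η f b D S x - batchStep R η f b D S y‖ ≤ c * ‖x - y‖)
    {B : Fin q → Finset (Fin n)} (hB : ∀ j, (B j).card = b) {D : Fin n → X}
    {ν ν' : Measure (EuclideanSpace ℝ (Fin d))} (hν : IsStationaryLaw R η σ f b B D ν)
    (hν' : IsStationaryLaw R η σ f b B D ν') : ν = ν' := by
  have := hν.isProbabilityMeasure
  have := hν'.isProbabilityMeasure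
  refine Measure.ext_of_charFun (funext fun t => ?_)
  have h0 : Coupled R (2 * R) ν ν' := Coupled.of_supported hν.supported hν'.supported
  have hk : ∀ k : ℕ, ‖charFun ν t - charFun ν' t‖ ≤ (c ^ q) ^ k * (2 * R) * ‖t‖ := by
    intro k
    have h1 := h0.epochs (σ := σ) hR hmeas hc hT hB D k
    rw [hν.iterate, hν'.iterate] at h1
    exact h1.norm_charFun_sub_le t
  have hl : Tendsto (fun k : ℕ => (c ^ q) ^ k * (2 * R) * ‖t‖) atTop (𝓝 0) := by
    simpa using ((tendsto_pow_atTop_nhds_zero_of_lt_one (pow_nonneg hc q) hq).mul_const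
      (2 * R)).mul_const ‖t‖
  exact sub_eq_zero.1 (norm_le_zero_iff.1 (ge_of_tendsto' hl hk))

theorem continuous_map_prod_const {E G H : Type*} [MetricSpace E] [SecondCountableTopology E]
    [MeasurableSpace E] [BorelSpace E] [MetricSpace G] [SecondCountableTopology G]
    [MeasurableSpace G] [BorelSpace G] [MetricSpace H] [MeasurableSpace H] [BorelSpace H]
    (γ : ProbabilityMeasure G) {F : E × G → H} (hF : Continuous F) :
    Continuous fun μ : ProbabilityMeasure E => (μ.prod γ).map hF.measurable.aemeasurable :=
  (ProbabilityMeasure.continuous_map hF).comp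
    (ProbabilityMeasure.continuous_prod.comp (continuous_id.prodMk continuous_const))

/-- The drift is continuous only on the ball; precomposition with the projection makes it globally
continuous without changing the law of the step. -/
theorem noisyLaw_eq_of_compl_paramBall (s : ℝ)
    (T : EuclideanSpace ℝ (Fin d) → EuclideanSpace ℝ (Fin d))
    {μ : Measure (EuclideanSpace ℝ (Fin d))} (hμ : μ (paramBall d R)ᶜ = 0) :
    noisyLaw R s (fun x => T (projBall R x)) μ = noisyLaw R s T μ := by
  refine Measure.map_congr ?_
  have a1 : ∀ᵐ p ∂(μ.prod (stdGaussian (EuclideanSpace ℝ (Fin d)))), p.1 ∈ paramBall d R :=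
    Measure.quasiMeasurePreserving_fst.ae (p := fun x => x ∈ paramBall d R) (mem_ae_iff.2 hμ)
  filter_upwards [a1] with p hp
  rw [projBall_of_mem hp]

/-- On laws supported in the ball, a noisy step is a continuous map. -/
theorem exists_continuous_noisyLaw (hR : 0 ≤ R) (s : ℝ)
    {T : EuclideanSpace ℝ (Fin d) → EuclideanSpace ℝ (Fin d)}
    (hTc : ContinuousOn T (paramBall d R)) :
    ∃ Ψ : ProbabilityMeasure (EuclideanSpace ℝ (Fin d)) →
        ProbabilityMeasure (EuclideanSpace ℝ (Fin d)), Continuous Ψ ∧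
      ∀ μ : ProbabilityMeasure (EuclideanSpace ℝ (Fin d)),
        (μ : Measure (EuclideanSpace ℝ (Fin d))) (paramBall d R)ᶜ = 0 →
        (Ψ μ : Measure (EuclideanSpace ℝ (Fin d))) = noisyLaw R s T μ := by
  have hTp : Continuous fun x => T (projBall R x) :=
    hTc.comp_continuous (continuous_projBall hR) (projBall_mem hR)
  have hF : Continuous fun p : EuclideanSpace ℝ (Fin d) × EuclideanSpace ℝ (Fin d) =>
      projBall R (T (projBall R p.1) + s • p.2) :=
    (continuous_projBall hR).comp
      ((hTp.comp continuous_fst).add (continuous_snd.const_smul s))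
  exact ⟨_, continuous_map_prod_const ⟨stdGaussian _, isProbabilityMeasure_stdGaussian⟩ hF,
    fun μ hμ => noisyLaw_eq_of_compl_paramBall s T hμ⟩

theorem exists_continuous_epochLaw (hR : 0 ≤ R)
    (hmeas : ∀ (D : Fin n → X) S, Measurable (batchStep R η f b D S))
    (D : Fin n → X) (B : Fin q → Finset (Fin n))
    (hTc : ∀ j, ContinuousOn (batchStep R η f b D (B j)) (paramBall d R)) :
    ∃ Φ : ProbabilityMeasure (EuclideanSpace ℝ (Fin d)) →
        ProbabilityMeasure (EuclideanSpace ℝ (Fin d)), Continuous Φ ∧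
      ∀ μ : ProbabilityMeasure (EuclideanSpace ℝ (Fin d)),
        (μ : Measure (EuclideanSpace ℝ (Fin d))) (paramBall d R)ᶜ = 0 →
        (Φ μ : Measure (EuclideanSpace ℝ (Fin d))) = epochLaw R η σ f b B D μ ∧
        (Φ μ : Measure (EuclideanSpace ℝ (Fin d))) (paramBall d R)ᶜ = 0 := by
  induction q with
  | zero => exact ⟨id, continuous_id, fun μ hμ => ⟨by rw [epochLaw_zero]; rfl, hμ⟩⟩
  | succ q ih =>
    obtain ⟨Φ, hΦ, hΦe⟩ := ih (fun j => B j.castSucc) fun j => hTc _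
    obtain ⟨Ψ, hΨ, hΨe⟩ := exists_continuous_noisyLaw hR (Real.sqrt (2 * η * σ ^ 2))
      (hTc (Fin.last q))
    refine ⟨Ψ ∘ Φ, hΨ.comp hΦ, fun μ hμ => ?_⟩
    obtain ⟨h1, h2⟩ := hΦe μ hμ
    rw [epochLaw_succ, noisyStep_eq_noisyLaw, ← h1, Function.comp_apply, hΨe _ h2]
    exact ⟨rfl, noisyLaw_compl_paramBall hR (hmeas _ _) _⟩

/-- Iterates of the epoch from a point mass have a cluster point `ν` among the laws on the ball.
Consecutive iterates merge, so `ν` and its image have the same characteristic function. -/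
theorem exists_isStationaryLaw (hR : 0 ≤ R)
    (hmeas : ∀ (D : Fin n → X) S, Measurable (batchStep R η f b D S)) (hc : 0 ≤ c)
    (hq : c ^ q < 1)
    (hT : ∀ (D : Fin n → X) (S : Finset (Fin n)), S.card = b → ∀ x ∈ paramBall d R,
      ∀ y ∈ paramBall d R, ‖batchStep R η f b D S x - batchStep R η f b D S y‖ ≤ c * ‖x - y‖)
    {B : Fin q → Finset (Fin n)} (hB : ∀ j, (B j).card = b) (D : Fin n → X) :
    ∃ ν, IsStationaryLaw R η σ f b B D ν := by
  have hTc : ∀ j, ContinuousOn (batchStep R η f b D (B j)) (paramBall d R) := fun j =>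
    (LipschitzOnWith.of_dist_le_mul (K := c.toNNReal) fun x hx y hy => by
      rw [dist_eq_norm, dist_eq_norm, Real.coe_toNNReal c hc]
      exact hT D _ (hB j) x hx y hy).continuousOn
  obtain ⟨Φ, hΦ, hΦe⟩ := exists_continuous_epochLaw (σ := σ) hR hmeas D B hTc
  have h0 : (Measure.dirac (0 : EuclideanSpace ℝ (Fin d))) (paramBall d R)ᶜ = 0 := by
    rw [Measure.dirac_apply' _ measurableSet_paramBall.compl]
    simp [mem_paramBall, hR]
  set μ₀ : ProbabilityMeasure (EuclideanSpace ℝ (Fin d)) := ⟨Measure.dirac 0, inferInstance⟩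
  set u : ℕ → ProbabilityMeasure (EuclideanSpace ℝ (Fin d)) := fun k => Φ^[k] μ₀ with hu
  have hus : ∀ k, (u k : Measure (EuclideanSpace ℝ (Fin d))) (paramBall d R)ᶜ = 0 := by
    intro k
    induction k with
    | zero => exact h0
    | succ k ih => simp only [hu, Function.iterate_succ_apply']; exact (hΦe _ ih).2
  have hue : ∀ k, (u (k + 1) : Measure (EuclideanSpace ℝ (Fin d))) =
      epochLaw R η σ f b B D (u k) := fun k => by
    have := (hΦe _ (hus k)).1
    rwa [hu, ← Function.iterate_succ_apply' Φ k μ₀] at this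
  have hcoup : ∀ k, Coupled R ((c ^ q) ^ k * (2 * R)) (u k : Measure (EuclideanSpace ℝ (Fin d)))
      (u (k + 1) : Measure (EuclideanSpace ℝ (Fin d))) := by
    intro k
    induction k with
    | zero => simpa using Coupled.of_supported (hus 0) (hus 1)
    | succ k ih =>
      rw [hue k, hue (k + 1), pow_succ', mul_assoc]
      exact ih.epoch hR hmeas hc hT hB D
  -- Tightness is trivial here: a constant sequence of compact sets, the ball, with escaping mass
  -- zero.
  have hcomp : IsCompact {μ : ProbabilityMeasure (EuclideanSpace ℝ (Fin d)) |
      ∀ _ : ℕ, μ (paramBall d R)ᶜ ≤ 0} :=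
    isCompact_setOfPred_probabilityMeasure_mass_eq_compl_isCompact_le (u := fun _ => 0)
      (K := fun _ => paramBall d R) tendsto_const_nhds
      (fun _ => isCompact_closedBall 0 R) (Or.inl inferInstance)
  -- Convergence along a nonprincipal ultrafilter takes the place of a convergent subsequence.
  obtain ⟨ν, hνS, hν⟩ := hcomp.ultrafilter_le_nhds ((hyperfilter ℕ).map u) (by
    rw [Ultrafilter.coe_map, le_principal_iff]
    refine Filter.mem_map.2 (Filter.univ_mem' fun k _ => ?_)
    rw [← ENNReal.coe_le_coe, ProbabilityMeasure.ennreal_coeFn_eq_coeFn_toMeasure, hus k]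
    exact le_rfl)
  have hνs : (ν : Measure (EuclideanSpace ℝ (Fin d))) (paramBall d R)ᶜ = 0 := by
    have := hνS 0
    rw [← ENNReal.coe_le_coe, ProbabilityMeasure.ennreal_coeFn_eq_coeFn_toMeasure] at this
    simpa using this
  have hlim : Tendsto u (hyperfilter ℕ) (𝓝 ν) := hν
  have hlim' : Tendsto (fun k => u (k + 1)) (hyperfilter ℕ) (𝓝 (Φ ν)) := by
    have := (hΦ.tendsto ν).comp hlim
    refine this.congr fun k => ?_
    simp only [hu, Function.comp_apply, Function.iterate_succ_apply']
  refine ⟨ν, inferInstance, hνs, ?_⟩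
  rw [← (hΦe ν hνs).1]
  refine Measure.ext_of_charFun (funext fun t => ?_)
  have hl : Tendsto (fun k : ℕ => (c ^ q) ^ k * (2 * R) * ‖t‖) atTop (𝓝 0) := by
    simpa using ((tendsto_pow_atTop_nhds_zero_of_lt_one (pow_nonneg hc q) hq).mul_const
      (2 * R)).mul_const ‖t‖
  have hl' := hl.mono_left Nat.hyperfilter_le_atTop
  have hd := (tendsto_charFun_of_tendsto hlim t).sub (tendsto_charFun_of_tendsto hlim' t)
  have h0 := squeeze_zero_norm (fun k => (hcoup k).norm_charFun_sub_le t) hl'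
  exact (sub_eq_zero.1 (tendsto_nhds_unique hd h0)).symm

end Stationary

/-! ### Rényi bounds for unlearning -/

section Unlearning

open Filter Topology

variable {X : Type*} {d n b q : ℕ} {R η σ c e δ α : ℝ} {f : X → EuclideanSpace ℝ (Fin d) → ℝ}

theorem isProbabilityMeasure_epochsLaw (hR : 0 ≤ R)
    (hmeas : ∀ (D : Fin n → X) S, Measurable (batchStep R η f b D S))
    (B : Fin q → Finset (Fin n)) (K : ℕ) (D : Fin n → X)
    (μ : Measure (EuclideanSpace ℝ (Fin d))) [IsProbabilityMeasure μ] :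
    IsProbabilityMeasure (epochsLaw R η σ f b B K D μ) := by
  induction K with
  | zero => simpa [epochsLaw]
  | succ K ih =>
    rw [epochsLaw, Function.iterate_succ_apply']
    have : IsProbabilityMeasure ((epochLaw R η σ f b B D)^[K] μ) := ih
    exact isProbabilityMeasure_epochLaw hR hmeas B D _

/-- Training from coupled laws: `W_∞` contraction up to the last step, whose noise is then converted
into a Rényi bound. -/
theorem Coupled.renyiDiff_epochsLaw_le (hR : 0 ≤ R) (hη : 0 < η) (hσ : 0 < σ) (hα : 1 < α)
    (hmeas : ∀ (D : Fin n → X) S, Measurable (batchStep R η f b D S)) (hc : 0 ≤ c)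
    (hT : ∀ (D : Fin n → X) (S : Finset (Fin n)), S.card = b → ∀ x ∈ paramBall d R,
      ∀ y ∈ paramBall d R, ‖batchStep R η f b D S x - batchStep R η f b D S y‖ ≤ c * ‖x - y‖)
    {B : Fin q → Finset (Fin n)} (hB : ∀ j, (B j).card = b) (hq : q ≠ 0) (D : Fin n → X)
    {K : ℕ} (hK : K ≠ 0) {μ μ' : Measure (EuclideanSpace ℝ (Fin d))} (h : Coupled R δ μ μ') :
    renyiDiff α (epochsLaw R η σ f b B K D μ) (epochsLaw R η σ f b B K D μ') ≤
      ((α * δ ^ 2 / (2 * η * σ ^ 2) * c ^ (2 * K * q) : ℝ) : EReal) := by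
  obtain ⟨K, rfl⟩ := Nat.exists_eq_add_one_of_ne_zero hK
  obtain ⟨q, rfl⟩ := Nat.exists_eq_add_one_of_ne_zero hq
  -- `K` and `q` are now one less than before: this covers every iteration except the last one of
  -- the last epoch.
  have h1 := (h.epochs (σ := σ) hR hmeas hc hT hB D K).epoch (σ := σ) hR hmeas hc hT
    (B := fun j : Fin q => B j.castSucc) (fun j => hB _) D
  have hs : 0 < Real.sqrt (2 * η * σ ^ 2) := Real.sqrt_pos.2 (by positivity)
  have h2 := h1.renyiDiff_noisyLaw_le hR hs hα hc (hmeas D (B (Fin.last q)))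
    (hT D _ (hB (Fin.last q)))
  have e1 : ∀ ν : Measure (EuclideanSpace ℝ (Fin d)), epochsLaw R η σ f b B (K + 1) D ν =
      noisyLaw R (Real.sqrt (2 * η * σ ^ 2)) (batchStep R η f b D (B (Fin.last q)))
        (epochLaw R η σ f b (fun j : Fin q => B j.castSucc) D (epochsLaw R η σ f b B K D ν)) := by
    intro ν
    rw [epochsLaw, Function.iterate_succ_apply', epochLaw_succ, noisyStep_eq_noisyLaw, epochsLaw]
  rw [e1, e1]
  refine h2.trans (EReal.coe_le_coe_iff.2 ?_)
  rw [Real.sq_sqrt (by positivity)]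
  have e2 : (c * (c ^ q * ((c ^ (q + 1)) ^ K * δ))) ^ 2 = δ ^ 2 * c ^ (2 * (K + 1) * (q + 1)) := by
    rw [← pow_mul]; ring
  rw [e2]
  -- The noise has variance `2 * η * σ ^ 2`, so the Gaussian bound has denominator `4 * η * σ ^ 2`:
  -- half of what is claimed.
  have e3 : α * (δ ^ 2 * c ^ (2 * (K + 1) * (q + 1))) / (2 * (2 * η * σ ^ 2)) =
      (α * δ ^ 2 / (2 * η * σ ^ 2) * c ^ (2 * (K + 1) * (q + 1))) / 2 := by
    field_simp
  rw [e3]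
  refine half_le_self ?_
  positivity

theorem renyiDiff_stationary_update_le (hR : 0 ≤ R) (hη : 0 < η) (hσ : 0 < σ) (hα : 1 < α)
    (hmeas : ∀ (D : Fin n → X) S, Measurable (batchStep R η f b D S)) (hc : 0 ≤ c) (hc1 : c ≤ 1)
    (hq : c ^ q < 1) (hq0 : q ≠ 0) (he : 0 ≤ e)
    (hT : ∀ (D : Fin n → X) (S : Finset (Fin n)), S.card = b → ∀ x ∈ paramBall d R,
      ∀ y ∈ paramBall d R, ‖batchStep R η f b D S x - batchStep R η f b D S y‖ ≤ c * ‖x - y‖)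
    {D : Fin n → X} {i : Fin n} {z : X}
    (hD : ∀ S, ∀ x ∈ paramBall d R, ‖batchStep R η f b D S x -
      batchStep R η f b (Function.update D i z) S x‖ ≤ if i ∈ S then e else 0)
    {B : Fin q → Finset (Fin n)} (hB : IsMinibatchSequence b B)
    {ν ν' : Measure (EuclideanSpace ℝ (Fin d))} (hν : IsStationaryLaw R η σ f b B D ν)
    (hν' : IsStationaryLaw R η σ f b B (Function.update D i z) ν') {K : ℕ} (hK : K ≠ 0) :
    renyiDiff α (epochsLaw R η σ f b B K (Function.update D i z) ν) ν' ≤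
      ((α * min (1 / (1 - c ^ q) * e) (2 * R) ^ 2 / (2 * η * σ ^ 2) * c ^ (2 * K * q) : ℝ) :
        EReal) := by
  have := hν.isProbabilityMeasure
  have := hν'.isProbabilityMeasure
  have key : ∀ δ, Coupled R δ ν ν' →
      renyiDiff α (epochsLaw R η σ f b B K (Function.update D i z) ν) ν' ≤
      ((α * δ ^ 2 / (2 * η * σ ^ 2) * c ^ (2 * K * q) : ℝ) : EReal) := by
    intro δ h
    have := h.renyiDiff_epochsLaw_le hR hη hσ hα hmeas hc hT hB.card_eq hq0 (Function.update D i z) hK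
    rwa [hν'.iterate] at this
  rcases min_choice (1 / (1 - c ^ q) * e) (2 * R) with hmin | hmin
  · rw [hmin]
    -- Couplings are known only at distances tending to `1 / (1 - c ^ q) * e`; the Rényi bound is
    -- continuous in `δ` and passes to the limit.
    have hl : Tendsto (fun k : ℕ => (c ^ q) ^ k * (2 * R) + 1 / (1 - c ^ q) * e) atTop
        (𝓝 (1 / (1 - c ^ q) * e)) := by
      simpa using ((tendsto_pow_atTop_nhds_zero_of_lt_one (pow_nonneg hc q) hq).mul_const
        (2 * R)).add_const (1 / (1 - c ^ q) * e)
    have hcont : Continuous fun δ : ℝ =>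
        ((α * δ ^ 2 / (2 * η * σ ^ 2) * c ^ (2 * K * q) : ℝ) : EReal) :=
      continuous_coe_real_ereal.comp (by fun_prop)
    exact ge_of_tendsto' ((hcont.tendsto _).comp hl) fun k =>
      key _ (coupled_stationary_update hR hmeas hc hc1 hq he hT hD hB hν hν' k)
  · rw [hmin]
    exact key _ (Coupled.of_supported hν.supported hν'.supported)

end Unlearning

/-! ### The zero-dimensional case -/

section DimensionZero

theorem measure_eq_of_subsingleton {E : Type*} [MeasurableSpace E] [Subsingleton E]
    (μ ν : Measure E) [IsProbabilityMeasure μ] [IsProbabilityMeasure ν] : μ = ν := by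
  ext s _
  refine Subsingleton.set_cases (p := fun s => μ s = ν s) ?_ ?_ s <;> simp

theorem renyiDiff_self {E : Type*} [MeasurableSpace E] (α : ℝ) (μ : Measure E)
    [IsProbabilityMeasure μ] : renyiDiff α μ μ = 0 := by
  have h : ∫⁻ x, (μ.rnDeriv μ x) ^ α ∂μ = 1 := by
    have : ∀ᵐ x ∂μ, (μ.rnDeriv μ x) ^ α = 1 := by
      filter_upwards [μ.rnDeriv_self] with x hx
      rw [hx, ENNReal.one_rpow]
    rw [lintegral_congr_ae this]; simp
  rw [renyiDiff, max_self, renyiDiv, if_pos Measure.AbsolutelyContinuous.rfl, h, ENNReal.log_one,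
    mul_zero]

end DimensionZero

end

theorem corollary3p6 {X : Type*} {d n b : ℕ} (hn : 0 < n) (hb : b ∣ n)
    (f : X → EuclideanSpace ℝ (Fin d) → ℝ) {R L M m η σ : ℝ}
    (hR : 0 < R) (hL : 0 < L) (hm : 0 < m) (hη : 0 < η) (hσ : 0 < σ)
    (hsmooth : ∀ z, IsSmoothLoss R L (f z))
    (hlip : ∀ z, IsLipschitzLoss R M (f z))
    (hconv : ∀ z, IsStronglyConvexLoss R m (f z))
    (hηL : η ≤ 1 / L)
    (B : Fin (n / b) → Finset (Fin n)) (hB : IsMinibatchSequence b B)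
    (c Z : ℝ) (hc : c = 1 - η * m)
    (hZ : Z = min (1 / (1 - c ^ (n / b)) * (2 * η * M / b)) (2 * R)) :
    (∀ D : Fin n → X, ∃! ν, IsStationaryLaw R η σ f b B D ν) ∧
    ∀ ν : (Fin n → X) → Measure (EuclideanSpace ℝ (Fin d)),
      (∀ D, IsStationaryLaw R η σ f b B D (ν D)) →
      ∀ (α : ℝ) (K : ℕ), 1 < α → 1 ≤ K →
        IsRenyiUnlearning α (α * Z ^ 2 / (2 * η * σ ^ 2) * c ^ (2 * K * (n / b))) ν
          (fun _ D' μ => epochsLaw R η σ f b B K D' μ) := by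
  have hb0 : 0 < b := Nat.pos_of_dvd_of_pos hb hn
  have hq0 : n / b ≠ 0 := (Nat.div_pos (Nat.le_of_dvd hn hb) hb0).ne'
  have hηL' : η * L ≤ 1 := by rwa [le_div_iff₀ hL] at hηL
  have hmeas : ∀ (D : Fin n → X) S, Measurable (batchStep R η f b D S) :=
    measurable_batchStep hsmooth
  -- Without data points there are no datasets, as `n ≥ 1`; otherwise the loss of `z₀` constrains
  -- the constants.
  rcases isEmpty_or_nonempty X with hX | ⟨⟨z₀⟩⟩
  · exact ⟨fun D => (hX.false (D ⟨0, hn⟩)).elim,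
      fun _ _ _ _ _ _ D => (hX.false (D ⟨0, hn⟩)).elim⟩
  -- In dimension zero the loss conditions force neither `m ≤ L` nor `0 ≤ M`, so `c` may be
  -- negative; but all probability measures coincide there.
  rcases Nat.eq_zero_or_pos d with rfl | hd
  · refine ⟨fun D => ⟨Measure.dirac 0, ⟨inferInstance, ?_, ?_⟩, fun ν hν => ?_⟩, ?_⟩
    · have : paramBall 0 R = Set.univ :=
        Set.eq_univ_of_forall fun x => mem_paramBall.2 (by rw [Subsingleton.elim x 0]; simpa using hR.le)
      simp [this]
    · have := isProbabilityMeasure_epochLaw (σ := σ) hR.le hmeas B D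
        (Measure.dirac (0 : EuclideanSpace ℝ (Fin 0)))
      exact measure_eq_of_subsingleton _ _
    · have := hν.isProbabilityMeasure
      exact measure_eq_of_subsingleton _ _
    · intro ν hν α K hα _ D D' _
      have h1 := (hν D).isProbabilityMeasure
      have h2 := (hν D').isProbabilityMeasure
      have h3 := isProbabilityMeasure_epochsLaw (σ := σ) hR.le hmeas B K D' (ν D)
      beta_reduce
      rw [measure_eq_of_subsingleton (epochsLaw R η σ f b B K D' (ν D)) (ν D'), renyiDiff_self]
      -- The exponent is even, so the sign of `c` is immaterial.
      have h4 : 0 ≤ c ^ (2 * K * (n / b)) := by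
        rw [mul_assoc, pow_mul]; positivity
      exact_mod_cast (by positivity :
        0 ≤ α * Z ^ 2 / (2 * η * σ ^ 2) * c ^ (2 * K * (n / b)))
  · have : Nonempty (Fin d) := ⟨⟨0, hd⟩⟩
    have hM : 0 ≤ M := (hlip z₀).nonneg hR
    have hmL : m ≤ L := strongConvexity_le_smoothness hR (hsmooth z₀) (hconv z₀)
    have hc0 : 0 ≤ c := by
      have := mul_le_mul_of_nonneg_left hmL hη.le
      linarith
    have hc1 : c < 1 := by
      have := mul_pos hη hm
      linarith
    have hq : c ^ (n / b) < 1 := pow_lt_one₀ hc0 hc1 hq0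
    have hT : ∀ (D : Fin n → X) (S : Finset (Fin n)), S.card = b → ∀ x ∈ paramBall d R,
        ∀ y ∈ paramBall d R,
          ‖batchStep R η f b D S x - batchStep R η f b D S y‖ ≤ c * ‖x - y‖ := by
      intro D S hS x hx y hy
      rw [hc]
      exact norm_batchStep_sub_le hR hη hηL' (hc ▸ hc0) hsmooth hconv D hb0 hS hx hy
    refine ⟨fun D => ?_, fun ν hν α K hα hK => ?_⟩
    · obtain ⟨ν, hν⟩ := exists_isStationaryLaw (σ := σ) hR.le hmeas hc0 hq hT hB.card_eq D
      exact ⟨ν, hν, fun ν' hν' => hν'.unique hR.le hmeas hc0 hq hT hB.card_eq hν⟩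
    · rintro D _ ⟨i, z, rfl⟩
      rw [hZ]
      exact renyiDiff_stationary_update_le hR.le hη hσ hα hmeas hc0 hc1.le hq hq0 (by positivity) hT
        (fun S x hx => norm_batchStep_update_sub_le hR hM hη hsmooth hlip D i z S hx) hB (hν D)
        (hν _) (Nat.one_le_iff_ne_zero.1 hK)
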